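/- Let $d\ge 1$. Let $\{Z_k : k=(k_1,\dots,k_d)\in\mathbb N^d\}$, $\mathbb N=\{1,2,\dots\}$, be independent, identically distributed real random variables with $\mathbb E Z_k=0$, $\mathbb E Z_k^2=1$ and $\mathbb E|Z_k|^m<\infty$ for every $m\in\mathbb N$. Let $H=(H_1,\dots,H_d)$ be a function on $\mathbb R_+^d$ (where $\mathbb R_+=[0,\infty)$) such that, for constants $\alpha_i,\beta_i$ ($1\le i\le d$), $K>0$ and $\gamma>0$, $$0<\alpha_i\le H_i(t)\le\beta_i<1\quad(1\le i\le d),\qquad \|H(t)-H(s)\|\le K\|t-s\|^{\gamma}\qquad\text{for all } s,t\in\mathbb R_+^d ,$$ with $\|\cdot\|$ the Euclidean norm. Write $x_+^p=x^p$ for $x>0$ and $x_+^p=0$ for $x\le 0$. For $n\in\mathbb N$ and $t\in[0,1]^d$ put $$\theta_n(u)=n^{d/2}\sum_{k\in\mathbb N^d}Z_k\,I_{[k_1-1,k_1)\times\cdots\times[k_d-1,k_d)}(nu),\qquad X_n(t)=\int_{\mathbb R_+^d}\Big[\prod_{i=1}^d(t_i-u_i)_+^{H_i(t)-\frac12}\Big]\theta_n(u)\,du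 .$$ Let $W$ be a $d$-parameter Wiener process on $\mathbb R_+^d$, i.e. a centred Gaussian process with almost surely continuous paths and covariance $\mathbb E[W(s)W(t)]=\prod_{i=1}^d\min(s_i,t_i)$, and let $$X(t)=\int_{\mathbb R_+^d}\prod_{i=1}^d(t_i-u_i)_+^{H_i(t)-\frac12}\,W(du),\qquad t\in[0,1]^d,$$ (Wiener integral) be the multifractional Riemann--Liouville Brownian sheet with Hurst functional $H$. Then the integrals defining $X_n(t)$ converge absolutely, $X_n$ has continuous paths on $[0,1]^d$, the process $X$ has a continuous modification on $[0,1]^d$, and, as $n\to\infty$, the laws of $X_n$ in $\mathcal C([0,1]^d)$ (with the uniform topology) converge weakly to the law in $\mathcal C([0,1]^d)$ of any continuous modification of $X$. -/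

import Mathlib

open MeasureTheory ProbabilityTheory Filter Topology
open scoped BigOperators

/-- The parameter set `ℝ₊ᵈ`. -/
abbrev Orthant (d : ℕ) : Type := Set.Ici (0 : Fin d → ℝ)

/-- The unit cube `[0,1]ᵈ`. -/
abbrev Cube (d : ℕ) : Type := Set.Icc (0 : Fin d → ℝ) 1

/-- `C([0,1]ᵈ)` carries the topology of uniform convergence and its Borel σ-algebra. -/
instance instMeasurableSpaceCube (d : ℕ) : MeasurableSpace C(Cube d, ℝ) := borel _

instance instBorelSpaceCube (d : ℕ) : BorelSpace C(Cube d, ℝ) := ⟨rfl⟩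

/-- The truncated power `x₊ ^ p`, equal to `x ^ p` for `x > 0` and to `0` for `x ≤ 0`
(also when `p = 0` or `p < 0`). -/
noncomputable def posPow (x p : ℝ) : ℝ := if 0 < x then x ^ p else 0

/-- The Riemann–Liouville kernel `u ↦ ∏ i, (t i - u i)₊ ^ (H i (t) - 1/2)`. -/
noncomputable def rlKernel {d : ℕ} (H : (Fin d → ℝ) → Fin d → ℝ) (t u : Fin d → ℝ) : ℝ :=
  ∏ i, posPow (t i - u i) (H t i - 1 / 2)

/-- The lattice cell `[k - 1, k) = [k₁ - 1, k₁) × ⋯ × [k_d - 1, k_d)`. -/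
def cell {d : ℕ} (k : Fin d → ℕ+) : Set (Fin d → ℝ) :=
  {v | ∀ i, ((k i : ℕ) : ℝ) - 1 ≤ v i ∧ v i < ((k i : ℕ) : ℝ)}

/-- `θ_n(u) = n^{d/2} ∑_k z_k 1_{[k-1,k)}(n u)`; at each `u` at most one summand is nonzero. -/
noncomputable def theta {d : ℕ} (z : (Fin d → ℕ+) → ℝ) (n : ℕ) (u : Fin d → ℝ) : ℝ :=
  (n : ℝ) ^ ((d : ℝ) / 2) * ∑' k, z k * (cell k).indicator 1 ((n : ℝ) • u)

/-- `X_n(t) = ∫_{ℝ₊ᵈ} ∏ i, (t i - u i)₊ ^ (H i (t) - 1/2) θ_n(u) du`. -/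
noncomputable def rlApprox {d : ℕ} (H : (Fin d → ℝ) → Fin d → ℝ) (z : (Fin d → ℕ+) → ℝ)
    (n : ℕ) (t : Fin d → ℝ) : ℝ :=
  ∫ u in Set.Ici (0 : Fin d → ℝ), rlKernel H t u * theta z n u

/-- `W` is a `d`-parameter Wiener process on `ℝ₊ᵈ`: a centred Gaussian process with covariance
`∏ i, min (s i) (t i)` and almost surely continuous sample paths. -/
structure IsWienerSheet {d : ℕ} {Ω : Type*} [MeasurableSpace Ω] (W : Orthant d → Ω → ℝ)
    (P : Measure Ω) : Prop where
  gaussian : IsGaussianProcess W P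
  centered : ∀ t, ∫ ω, W t ω ∂P = 0
  covariance_eq : ∀ s t : Orthant d, cov[W s, W t; P] = ∏ i, min (s.1 i) (t.1 i)
  continuous_paths : ∀ᵐ ω ∂P, Continuous fun t => W t ω

/-- The step function `∑_s c_s 1_{[0,s]}` on `ℝ₊ᵈ`. -/
noncomputable def stepFun {d : ℕ} (c : Orthant d →₀ ℝ) (u : Fin d → ℝ) : ℝ :=
  c.sum fun s a => a * (Set.Icc (0 : Fin d → ℝ) s.1).indicator 1 u

/-- The Wiener integral `∑_s c_s W(s)` of the step function `∑_s c_s 1_{[0,s]}`. -/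
noncomputable def stepIntegral {d : ℕ} {Ω : Type*} (W : Orthant d → Ω → ℝ)
    (c : Orthant d →₀ ℝ) (ω : Ω) : ℝ :=
  c.sum fun s a => a * W s ω

/-- `Y = ∫_{ℝ₊ᵈ} f(u) W(du)` almost surely: `f` lies in `L²(ℝ₊ᵈ)`, `Y` in `L²(P)`, and there are
step functions converging to `f` in `L²(ℝ₊ᵈ)` whose integrals converge to `Y` in `L²(P)`. -/
def IsWienerIntegral {d : ℕ} {Ω : Type*} [MeasurableSpace Ω] (W : Orthant d → Ω → ℝ)
    (P : Measure Ω) (f : (Fin d → ℝ) → ℝ) (Y : Ω → ℝ) : Prop :=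
  MemLp f 2 (volume.restrict (Set.Ici 0)) ∧ MemLp Y 2 P ∧
    ∃ c : ℕ → Orthant d →₀ ℝ,
      Tendsto (fun m => eLpNorm (fun u => stepFun (c m) u - f u) 2
        (volume.restrict (Set.Ici 0))) atTop (𝓝 0) ∧
      Tendsto (fun m => eLpNorm (fun ω => stepIntegral W (c m) ω - Y ω) 2 P) atTop (𝓝 0)

/-- `X`, a random element of `C([0,1]ᵈ)`, is a continuous modification of the multifractional
Riemann–Liouville Brownian sheet driven by `W`: for each `t`, almost surely
`X(t) = ∫_{ℝ₊ᵈ} ∏ i, (t i - u i)₊ ^ (H i (t) - 1/2) W(du)`. -/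
def IsContinuousRLSheet {d : ℕ} {Ω : Type*} [MeasurableSpace Ω] (H : (Fin d → ℝ) → Fin d → ℝ)
    (W : Orthant d → Ω → ℝ) (P : Measure Ω) (X : Ω → C(Cube d, ℝ)) : Prop :=
  ∀ t : Cube d, IsWienerIntegral W P (rlKernel H t) (fun ω => X ω t)

/-! For `t` in the cube the kernel `K_t` vanishes on the orthant outside `[0,1)^d`, so `X_n(t)` is a
finite linear form `∑ a_{n,k}(t) Z_k`, where `a_{n,k}(t)` is `n^{d/2}` times the integral of `K_t`
over a cell of side `1/n` (`rlKernel_mul_theta_integrable`). Up to normalisation these coefficients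
are the coordinates of the orthogonal projection of `K_t` onto functions constant on cells. Bessel's
inequality therefore bounds the `ℓ²` increments of the coefficients by the `L²` increments of the
kernel, uniformly in `n`, and these are at most `C * dist s t ^ η` (`exists_rlKernel_increment_le`).

Tightness: `exists_moment_sum_le` turns the `ℓ²` bound into bounds for moments of arbitrarily high
even order. Once the order is large compared with `d / η`, chaining over dyadic grids gives a common
modulus of continuity with high probability, and Arzelà–Ascoli gives compactness
(`isTightMeasureSet_of_moments`). The same chaining, fed with Gaussian moments, yields the
continuous modification of `X` (`exists_continuous_modification`).

Identification of the limit: a linear combination of values of `X_n` has as coefficients the cell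
coefficients of one function `f`, the same combination of kernels. Their squares sum to a quantity
tending to `‖f‖²` and their maximum tends to `0`, so `tendsto_charFun_weighted_sum` gives the limit
`N(0, ‖f‖²)`. By linearity and the isometry of the Wiener integral this is the law of the same
combination of values of `X` (`IsWienerIntegral.map_eq`). Tightness and these characteristic
functions determine the weak limit (`tendstoInDistribution_of_isTightMeasureSet`). -/

/-! ### Even moments of weighted sums of independent variables -/

/-- The term linear in `y` is kept exact because its expectation vanishes for independent centred
`y`. Every binomial term with at least two factors `y` lies between the two extreme monomials
multiplied by `B`. -/
theorem exists_add_pow_le (m : ℕ) : ∃ B : ℝ, 0 ≤ B ∧ ∀ s y : ℝ,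
    (s + y) ^ (2 * m + 2) ≤ s ^ (2 * m + 2) + (2 * m + 2) * (s ^ (2 * m + 1) * y) +
      B * (y ^ 2 * s ^ (2 * m) + y ^ (2 * m + 2)) := by
  induction m with
  | zero => exact ⟨1, zero_le_one, fun s y => by norm_num; nlinarith [sq_nonneg y]⟩
  | succ m ih =>
    obtain ⟨B, hB, h⟩ := ih
    -- Multiplying the `B` part by `(s + y)² ≤ 2(s² + y²)` gives four monomials with factor `2B`;
    -- each of the two mixed ones costs both extremes, whence `6B`. The other terms cost at most `6m
    -- + 7`.
    refine ⟨6 * B + 8 * m + 8, by positivity, fun s y => ?_⟩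
    have key : ∀ a b : ℝ, 0 ≤ a → 0 ≤ b → a ^ m * b ≤ a ^ (m + 1) + b ^ (m + 1) := by
      intro a b ha hb
      rcases le_total a b with hab | hab
      · calc a ^ m * b ≤ b ^ m * b := by gcongr
          _ ≤ a ^ (m + 1) + b ^ (m + 1) := by rw [← pow_succ]; linarith [pow_nonneg ha (m + 1)]
      · calc a ^ m * b ≤ a ^ m * a := by gcongr
          _ ≤ a ^ (m + 1) + b ^ (m + 1) := by rw [← pow_succ]; linarith [pow_nonneg hb (m + 1)]
    have k1 := key (s ^ 2) (y ^ 2) (sq_nonneg _) (sq_nonneg _)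
    have k2 := key (y ^ 2) (s ^ 2) (sq_nonneg _) (sq_nonneg _)
    have h1 := mul_le_mul_of_nonneg_right (h s y) (sq_nonneg (s + y))
    have e : ∀ x : ℝ, x ^ (2 * m) = (x ^ 2) ^ m := fun x => pow_mul x 2 m
    have hs : 0 ≤ (s ^ 2) ^ m := by positivity
    have hy : 0 ≤ (y ^ 2) ^ m := by positivity
    have e1 : 2 * (m + 1) + 2 = 2 * m + 2 + 2 := by ring
    have e2 : 2 * (m + 1) + 1 = 2 * m + 1 + 2 := by ring
    have e3 : 2 * (m + 1) = 2 * m + 2 := by ring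
    rw [e1, e2, e3]
    simp only [pow_add _ (2 * m), e, pow_add _ m, pow_one, Nat.cast_add, Nat.cast_one,
      pow_add _ (2 * m + 2), pow_add _ (2 * m + 1)] at h1 k1 k2 ⊢
    generalize (s ^ 2) ^ m = S at *
    generalize (y ^ 2) ^ m = Y at *
    have hA := mul_le_mul_of_nonneg_right k1 (sq_nonneg y)
    have hC := mul_le_mul_of_nonneg_right k2 (sq_nonneg y)
    have hD : S * y ^ 2 * (s * y) ≤ S * y ^ 2 * ((s ^ 2 + y ^ 2) / 2) := by
      apply mul_le_mul_of_nonneg_left _ (by positivity)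
      nlinarith [sq_nonneg (s - y)]
    have hE : (y ^ 2 * S + Y * y ^ 2) * (s + y) ^ 2 ≤
        (y ^ 2 * S + Y * y ^ 2) * (2 * (s ^ 2 + y ^ 2)) := by
      apply mul_le_mul_of_nonneg_left _ (by positivity)
      nlinarith [sq_nonneg (s - y)]
    have hF := mul_le_mul_of_nonneg_left hE hB
    have hm : (0 : ℝ) ≤ m := Nat.cast_nonneg m
    have hD' := mul_le_mul_of_nonneg_left hD (by positivity : (0 : ℝ) ≤ 2 * m + 2)
    have hA' := mul_le_mul_of_nonneg_left hA (by positivity : (0 : ℝ) ≤ 2 * B + (m + 1))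
    have hC' := mul_le_mul_of_nonneg_left hC (by positivity : (0 : ℝ) ≤ 2 * B)
    have p1 : 0 ≤ S * s ^ 2 * y ^ 2 := by positivity
    have p2 : 0 ≤ Y * y ^ 2 * y ^ 2 := by positivity
    have p3 : 0 ≤ (m : ℝ) * (S * s ^ 2 * y ^ 2) := by positivity
    have p4 : 0 ≤ (m : ℝ) * (Y * y ^ 2 * y ^ 2) := by positivity
    have p5 : 0 ≤ B * (S * s ^ 2 * y ^ 2) := by positivity
    have p6 : 0 ≤ B * (Y * y ^ 2 * y ^ 2) := by positivity
    linarith [h1, hF, hD', hA', hC', p1, p2, p3, p4, p5, p6]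

/-- A Rosenthal-type inequality: even moments of weighted sums of independent centred variables
with uniformly bounded moments are controlled by the sum of the squared weights. -/
theorem exists_moment_sum_le {Ω ι : Type*} [MeasurableSpace Ω] {P : Measure Ω}
    [IsProbabilityMeasure P] {Z : ι → Ω → ℝ} (hmeas : ∀ k, Measurable (Z k))
    (hindep : iIndepFun Z P) (hmean : ∀ k, ∫ ω, Z k ω ∂P = 0)
    (hint : ∀ k (m : ℕ), Integrable (fun ω => |Z k ω| ^ m) P)
    {M : ℕ → ℝ} (hM : ∀ k m, ∫ ω, Z k ω ^ (2 * m) ∂P ≤ M m) (m : ℕ) :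
    ∃ C : ℝ, 0 ≤ C ∧ ∀ (s : Finset ι) (a : ι → ℝ),
      Integrable (fun ω => (∑ i ∈ s, a i * Z i ω) ^ (2 * m)) P ∧
      ∫ ω, (∑ i ∈ s, a i * Z i ω) ^ (2 * m) ∂P ≤ C * (∑ i ∈ s, a i ^ 2) ^ m := by
  classical
  have hLp : ∀ k (p : ℕ), MemLp (Z k) p P := by
    intro k p
    rcases Nat.eq_zero_or_pos p with rfl | hp
    · simpa using (hmeas k).aestronglyMeasurable
    rw [← memLp_norm_rpow_iff (q := (p : ENNReal)) (hmeas k).aestronglyMeasurable (by positivity)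
      (by simp), ENNReal.div_self (by positivity) (by simp), memLp_one_iff_integrable]
    simpa using hint k p
  have hSLp : ∀ (s : Finset ι) (a : ι → ℝ) (p : ℕ), MemLp (fun ω => ∑ i ∈ s, a i * Z i ω) p P :=
    fun s a p => memLp_finsetSum s fun i _ => (hLp i p).const_mul (a i)
  have hpow : ∀ {f : Ω → ℝ}, (∀ p : ℕ, MemLp f p P) → ∀ p : ℕ, Integrable (fun ω => f ω ^ p) P := by
    intro f hf p
    refine (hf p).integrable_norm_pow' |>.mono' ?_ ?_
    · exact (hf p).aestronglyMeasurable.pow p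
    · exact ae_of_all _ fun ω => by simp
  induction m with
  | zero => exact ⟨1, zero_le_one, fun s a => by simp⟩
  | succ m ih =>
    obtain ⟨C, hC0, hC⟩ := ih
    obtain ⟨B, hB0, hB⟩ := exists_add_pow_le m
    refine ⟨B * (C * |M 1| + |M (m + 1)|), by positivity, fun s a => ⟨hpow (hSLp s a) _, ?_⟩⟩
    induction s using Finset.induction_on with
    | empty => simp
    | insert j s hj ihs =>
      set S : Ω → ℝ := fun ω => ∑ i ∈ s, a i * Z i ω with hS
      have hind : IndepFun S (Z j) P := by
        -- The weight of `j` is reset to `1`, so that the independence obtained concerns `Z j`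
        -- itself even if `a j = 0`.
        have h1 : iIndepFun (fun i ω => (if i = j then 1 else a i) * Z i ω) P :=
          hindep.comp (fun i x => (if i = j then 1 else a i) * x) (fun i => by fun_prop)
        have h2 := h1.indepFun_finsetSum_of_notMem
          (fun i => (hmeas i).const_mul _) hj
        convert! h2 using 1
        · ext ω
          simp only [hS, Finset.sum_apply]
          refine Finset.sum_congr rfl fun i hi => ?_
          have : i ≠ j := fun h => hj (h ▸ hi)
          simp [this]
        · ext ω; simp
      have hi1 : ∀ p r : ℕ, IndepFun (fun ω => S ω ^ p) (fun ω => Z j ω ^ r) P := fun p r =>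
        hind.comp (φ := fun x : ℝ => x ^ p) (ψ := fun x : ℝ => x ^ r) (by fun_prop) (by fun_prop)
      have hIS := hpow (hSLp s a)
      have hIZ := hpow (hLp j)
      have hprod : ∀ p r : ℕ, Integrable (fun ω => S ω ^ p * Z j ω ^ r) P := fun p r =>
        (hi1 p r).integrable_mul (hIS p) (hIZ r)
      have hprodE : ∀ p r : ℕ, ∫ ω, S ω ^ p * Z j ω ^ r ∂P =
          (∫ ω, S ω ^ p ∂P) * ∫ ω, Z j ω ^ r ∂P := fun p r =>
        (hi1 p r).integral_mul_eq_mul_integral (hIS p).aestronglyMeasurable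
          (hIZ r).aestronglyMeasurable
      have hVnn : 0 ≤ ∑ i ∈ s, a i ^ 2 := Finset.sum_nonneg fun i _ => sq_nonneg _
      set V := ∑ i ∈ s, a i ^ 2 with hV
      have hZ1 : ∫ ω, Z j ω ^ 1 ∂P = 0 := by simpa using hmean j
      have j1 : Integrable (fun ω => S ω ^ (2 * m + 2)) P := hIS _
      have j2 : Integrable
          (fun ω => (2 * m + 2) * a j * (S ω ^ (2 * m + 1) * Z j ω ^ 1)) P := (hprod _ _).const_mul _
      have j3 : Integrable (fun ω => B * a j ^ 2 * (S ω ^ (2 * m) * Z j ω ^ 2)) P :=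
        (hprod _ _).const_mul _
      have j4 : Integrable (fun ω => B * a j ^ (2 * m + 2) * Z j ω ^ (2 * m + 2)) P :=
        (hIZ _).const_mul _
      have j12 : Integrable (fun ω => S ω ^ (2 * m + 2) +
          (2 * m + 2) * a j * (S ω ^ (2 * m + 1) * Z j ω ^ 1)) P := j1.add j2
      have j34 : Integrable (fun ω => B * a j ^ 2 * (S ω ^ (2 * m) * Z j ω ^ 2) +
          B * a j ^ (2 * m + 2) * Z j ω ^ (2 * m + 2)) P := j3.add j4
      have step : ∫ ω, (∑ i ∈ insert j s, a i * Z i ω) ^ (2 * (m + 1)) ∂P ≤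
          ∫ ω, (S ω ^ (2 * m + 2) + (2 * m + 2) * a j * (S ω ^ (2 * m + 1) * Z j ω ^ 1) +
            (B * a j ^ 2 * (S ω ^ (2 * m) * Z j ω ^ 2) +
              B * a j ^ (2 * m + 2) * Z j ω ^ (2 * m + 2))) ∂P := by
        refine integral_mono (hpow (hSLp _ a) _) ?_ fun ω => ?_
        · exact j12.add j34
        · have := hB (S ω) (a j * Z j ω)
          simp only [Finset.sum_insert hj]
          rw [add_comm (a j * Z j ω), show 2 * (m + 1) = 2 * m + 2 by ring]
          refine this.trans (le_of_eq ?_)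
          simp only [mul_pow]
          ring
      rw [integral_add j12 j34, integral_add j1 j2, integral_add j3 j4,
        integral_const_mul, integral_const_mul, integral_const_mul, hprodE, hprodE, hZ1] at step
      have b1 : (∫ ω, S ω ^ (2 * m) ∂P) * ∫ ω, Z j ω ^ 2 ∂P ≤ C * V ^ m * |M 1| := by
        refine mul_le_mul (hC s a).2 ((hM j 1).trans (le_abs_self _)) ?_ (by positivity)
        exact integral_nonneg fun ω => sq_nonneg (Z j ω)
      have b2 : ∫ ω, Z j ω ^ (2 * m + 2) ∂P ≤ |M (m + 1)| :=
        (hM j (m + 1)).trans (le_abs_self _)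
      rw [Finset.sum_insert hj, ← hV]
      have hpos : (0 : ℝ) ≤ a j ^ 2 := sq_nonneg _
      set x := a j ^ 2 with hx
      have hx2 : a j ^ (2 * m + 2) = x * x ^ m := by rw [hx]; ring
      have c1 : V ^ m ≤ (x + V) ^ m := by gcongr; linarith
      have c2 : x ^ m ≤ (x + V) ^ m := by gcongr; linarith
      -- This superadditivity absorbs the new variable without enlarging the constant, so the bound
      -- does not depend on the size of `s`.
      have c3 : V ^ (m + 1) + x * (x + V) ^ m ≤ (x + V) ^ (m + 1) := by
        rw [pow_succ, pow_succ]
        nlinarith [mul_le_mul_of_nonneg_right c1 hVnn]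
      calc _ ≤ _ := step
        _ ≤ B * (C * |M 1| + |M (m + 1)|) * V ^ (m + 1) + 0 +
            (B * x * (C * (x + V) ^ m * |M 1|) + B * (x * (x + V) ^ m) * |M (m + 1)|) := by
          rw [hx2]
          refine add_le_add (add_le_add ihs (by simp)) (add_le_add ?_ ?_)
          · exact mul_le_mul_of_nonneg_left (b1.trans (by gcongr)) (by positivity)
          · refine mul_le_mul (by gcongr) b2 ?_ (by positivity)
            exact integral_nonneg fun ω => (even_two_mul (m + 1)).pow_nonneg (Z j ω)
        _ = B * (C * |M 1| + |M (m + 1)|) * (V ^ (m + 1) + x * (x + V) ^ m) := by ring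
        _ ≤ _ := by gcongr

/-! ### Central limit theorem for weighted sums -/

/-- Telescoping: factors are exchanged one at a time, and the remaining ones have norm at most `1`.
It compares a product of characteristic functions with its Gaussian counterpart. -/
theorem norm_prod_sub_prod_le_sum {ι R : Type*} [NormedCommRing R] [NormOneClass R] (s : Finset ι)
    (f g : ι → R) (hf : ∀ i ∈ s, ‖f i‖ ≤ 1) (hg : ∀ i ∈ s, ‖g i‖ ≤ 1) :
    ‖∏ i ∈ s, f i - ∏ i ∈ s, g i‖ ≤ ∑ i ∈ s, ‖f i - g i‖ := by
  classical
  induction s using Finset.induction_on with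
  | empty => simp
  | insert j s hj ih =>
    simp only [Finset.mem_insert, forall_eq_or_imp] at hf hg
    have hgs : ‖∏ i ∈ s, g i‖ ≤ 1 :=
      (Finset.norm_prod_le s g).trans (Finset.prod_le_one (fun i _ => norm_nonneg _) hg.2)
    rw [Finset.prod_insert hj, Finset.prod_insert hj, Finset.sum_insert hj]
    calc ‖f j * ∏ i ∈ s, f i - g j * ∏ i ∈ s, g i‖
        = ‖(f j - g j) * ∏ i ∈ s, g i + f j * (∏ i ∈ s, f i - ∏ i ∈ s, g i)‖ := by ring_nf
      _ ≤ ‖f j - g j‖ * ‖∏ i ∈ s, g i‖ + ‖f j‖ * ‖∏ i ∈ s, f i - ∏ i ∈ s, g i‖ :=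
        (norm_add_le _ _).trans (add_le_add (norm_mul_le _ _) (norm_mul_le _ _))
      _ ≤ ‖f j - g j‖ * 1 + 1 * ∑ i ∈ s, ‖f i - g i‖ := by
        gcongr
        · exact hf.1
        · exact ih hf.2 hg.2
      _ = _ := by ring

/-- A central limit theorem for weighted sums, in terms of characteristic functions. -/
theorem tendsto_charFun_weighted_sum {Ω ι : Type*} [MeasurableSpace Ω] {P : Measure Ω}
    [IsProbabilityMeasure P] {Z : ι → Ω → ℝ} (hmeas : ∀ k, Measurable (Z k))
    (hindep : iIndepFun Z P) (hident : ∀ j k, IdentDistrib (Z j) (Z k) P P)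
    (hmean : ∀ k, ∫ ω, Z k ω ∂P = 0) (hvar : ∀ k, ∫ ω, Z k ω ^ 2 ∂P = 1)
    (s : ℕ → Finset ι) (a : ℕ → ι → ℝ) (v : ℝ)
    (hsum : Tendsto (fun n => ∑ i ∈ s n, a n i ^ 2) atTop (𝓝 v))
    (hmax : ∀ ε > 0, ∀ᶠ n in atTop, ∀ i ∈ s n, |a n i| < ε) :
    Tendsto (fun n => charFun (P.map fun ω => ∑ i ∈ s n, a n i * Z i ω) 1) atTop
      (𝓝 (Complex.exp (-(v : ℂ) / 2))) := by
  rcases isEmpty_or_nonempty ι with hι | ⟨⟨j⟩⟩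
  · have h0 : ∀ n, s n = ∅ := fun n => Finset.eq_empty_of_isEmpty _
    simp only [h0, Finset.sum_empty] at hsum ⊢
    have : v = 0 := tendsto_nhds_unique hsum tendsto_const_nhds
    simp [this]
  set φ := charFun (P.map (Z j)) with hφ
  have hprod : ∀ n, charFun (P.map fun ω => ∑ i ∈ s n, a n i * Z i ω) 1 =
      ∏ i ∈ s n, φ (a n i) := by
    intro n
    have h1 : iIndepFun (fun i ω => a n i * Z i ω) P :=
      hindep.comp (fun i x => a n i * x) (fun i => by fun_prop)
    rw [(h1.restrict (s n)).charFun_map_fun_finsetSum_eq_prod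
      (fun i _ => ((hmeas i).const_mul _).aemeasurable), Finset.prod_apply]
    refine Finset.prod_congr rfl fun i _ => ?_
    rw [charFun_map_mul_comp, (hident i j).map_eq, mul_one]
    exact (hmeas i).aemeasurable
  have hexp : ∀ n, Complex.exp (-((∑ i ∈ s n, a n i ^ 2 : ℝ) : ℂ) / 2) =
      ∏ i ∈ s n, Complex.exp (-((a n i : ℂ) ^ 2) / 2) := by
    intro n
    rw [← Complex.exp_sum, ← Finset.sum_div, Finset.sum_neg_distrib]
    push_cast
    rfl
  have hlim : Tendsto (fun n => Complex.exp (-((∑ i ∈ s n, a n i ^ 2 : ℝ) : ℂ) / 2)) atTop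
      (𝓝 (Complex.exp (-(v : ℂ) / 2))) := by
    refine (Continuous.tendsto (by fun_prop : Continuous fun x : ℝ =>
      Complex.exp (-(x : ℂ) / 2)) v).comp hsum
  -- Both functions are `1 - x² / 2 + o(x²)`. Uniformly small weights then make the error of each
  -- factor a small multiple of its squared weight, and these errors can be summed.
  have ho : (fun x : ℝ => φ x - Complex.exp (-((x : ℂ) ^ 2) / 2)) =o[𝓝 0] fun x : ℝ => x ^ 2 := by
    have h1 := taylor_charFun_two (P := P) (hmeas j).aemeasurable (hmean j)
      (by simpa using hvar j)
    have h2 : (fun x : ℝ => Complex.exp (-((x : ℂ) ^ 2) / 2) - (1 - (x : ℂ) ^ 2 / 2))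
        =o[𝓝 0] fun x : ℝ => x ^ 2 := by
      have h3 : (fun x : ℝ => Complex.exp (-((x : ℂ) ^ 2) / 2) - (1 - (x : ℂ) ^ 2 / 2))
          =O[𝓝 0] fun x : ℝ => x ^ 4 := by
        refine Asymptotics.IsBigO.of_bound 1 ?_
        filter_upwards [Metric.ball_mem_nhds (0 : ℝ) one_pos] with x hx
        have hx' : |x| < 1 := by simpa using hx
        have hn : ‖-((x : ℂ) ^ 2) / 2‖ = x ^ 2 / 2 := by simp
        have hx2 : x ^ 2 ≤ 1 := by
          rw [← sq_abs]; exact pow_le_one₀ (abs_nonneg _) hx'.le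
        have := Complex.norm_exp_sub_one_sub_id_le (x := -((x : ℂ) ^ 2) / 2)
          (by rw [hn]; linarith)
        rw [hn] at this
        rw [show (1 - (x : ℂ) ^ 2 / 2) = 1 + -((x : ℂ) ^ 2) / 2 by ring, ← sub_sub]
        refine this.trans ?_
        rw [Real.norm_eq_abs, abs_of_nonneg (by positivity : (0 : ℝ) ≤ x ^ 4)]
        nlinarith [sq_nonneg (x ^ 2)]
      exact h3.trans_isLittleO (Asymptotics.isLittleO_pow_pow (by norm_num))
    refine (h1.sub h2).congr_left fun x => ?_
    ring
  have hdiff : Tendsto (fun n => charFun (P.map fun ω => ∑ i ∈ s n, a n i * Z i ω) 1 -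
      Complex.exp (-((∑ i ∈ s n, a n i ^ 2 : ℝ) : ℂ) / 2)) atTop (𝓝 0) := by
    rw [NormedAddGroup.tendsto_nhds_zero]
    intro ε hε
    have hv1 : ∀ᶠ n in atTop, ∑ i ∈ s n, a n i ^ 2 < |v| + 1 :=
      hsum.eventually_lt_const (by linarith [le_abs_self v])
    have hv0 : 0 < |v| + 1 := by positivity
    have h1 := ho.def (c := ε / (|v| + 1)) (by positivity)
    obtain ⟨δ, hδ, hδ'⟩ := Metric.eventually_nhds_iff.1 h1
    filter_upwards [hv1, hmax δ hδ] with n hn1 hn2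
    rw [hprod, hexp]
    have : IsProbabilityMeasure (P.map (Z j)) :=
      Measure.isProbabilityMeasure_map (hmeas j).aemeasurable
    calc _ ≤ ∑ i ∈ s n, ‖φ (a n i) - Complex.exp (-((a n i : ℂ) ^ 2) / 2)‖ := by
          refine norm_prod_sub_prod_le_sum _ _ _ (fun i _ => norm_charFun_le_one _) fun i _ => ?_
          rw [Complex.norm_exp]
          norm_cast
          rw [Real.exp_le_one_iff]
          have := sq_nonneg (a n i)
          linarith
      _ ≤ ∑ i ∈ s n, ε / (|v| + 1) * a n i ^ 2 := by
          refine Finset.sum_le_sum fun i hi => ?_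
          have := hδ' (y := a n i) (by simpa using hn2 i hi)
          simpa using this
      _ = ε / (|v| + 1) * ∑ i ∈ s n, a n i ^ 2 := by rw [Finset.mul_sum]
      _ < ε / (|v| + 1) * (|v| + 1) := by gcongr
      _ = ε := by field_simp
  simpa using hdiff.add hlim

/-! ### Dyadic grids and chaining -/

/-- The point `k / 2 ^ m` of the dyadic grid of level `m` in the unit cube. -/
noncomputable def gridPt {d : ℕ} (m : ℕ) (k : Fin d → Fin (2 ^ m + 1)) : Cube d :=
  ⟨fun i => (k i : ℝ) / 2 ^ m, fun i => by simp only [Pi.zero_apply]; positivity, fun i => by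
    simp only [Pi.one_apply]
    rw [div_le_one (by positivity)]
    exact_mod_cast Nat.lt_succ_iff.1 (k i).2⟩

theorem Cube.nonneg {d : ℕ} (t : Cube d) (i : Fin d) : 0 ≤ t.1 i := t.2.1 i

theorem Cube.le_one {d : ℕ} (t : Cube d) (i : Fin d) : t.1 i ≤ 1 := t.2.2 i

/-- The index of the grid cell of level `m` that contains `t`. -/
noncomputable def gridIdx {d : ℕ} (m : ℕ) (t : Cube d) (i : Fin d) : Fin (2 ^ m + 1) :=
  ⟨⌊2 ^ m * t.1 i⌋₊, by
    refine Nat.lt_succ_iff.2 (Nat.floor_le_of_le ?_)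
    push_cast
    exact mul_le_of_le_one_right (by positivity) (t.le_one i)⟩

/-- The lower corner of the grid cell of level `m` that contains `t`. -/
noncomputable def gridFloor {d : ℕ} (m : ℕ) (t : Cube d) : Cube d := gridPt m (gridIdx m t)

theorem gridFloor_apply {d : ℕ} (m : ℕ) (t : Cube d) (i : Fin d) :
    (gridFloor m t).1 i = (⌊2 ^ m * t.1 i⌋₊ : ℝ) / 2 ^ m := rfl

theorem Cube.dist_le_iff {d : ℕ} {s t : Cube d} {r : ℝ} (hr : 0 ≤ r) :
    dist s t ≤ r ↔ ∀ i, |s.1 i - t.1 i| ≤ r := by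
  rw [Subtype.dist_eq, dist_pi_le_iff hr]
  rfl

/-- After rescaling by `2 ^ m`, coordinates at distance at most `1` have integer parts differing by
less than `2`, hence by at most `1`. -/
theorem dist_gridFloor_gridFloor_le {d m : ℕ} {s t : Cube d} (h : dist s t ≤ (1 / 2) ^ m) :
    dist (gridFloor m s) (gridFloor m t) ≤ (1 / 2) ^ m := by
  rw [Cube.dist_le_iff (by positivity)] at h ⊢
  intro i
  have hi := h i
  rw [gridFloor_apply, gridFloor_apply, ← sub_div, abs_div, abs_of_pos (by positivity : (0:ℝ) < 2 ^ m),
    div_le_iff₀ (by positivity), ← mul_pow, show (1 / 2 * 2 : ℝ) = 1 by norm_num, one_pow]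
  have ha : |2 ^ m * s.1 i - 2 ^ m * t.1 i| ≤ 1 := by
    rw [← mul_sub, abs_mul, abs_of_pos (by positivity : (0:ℝ) < 2 ^ m)]
    calc (2:ℝ) ^ m * |s.1 i - t.1 i| ≤ 2 ^ m * (1 / 2) ^ m := by gcongr
      _ = 1 := by rw [← mul_pow]; norm_num
  have h1 := Nat.floor_le (mul_nonneg (by positivity : (0:ℝ) ≤ 2 ^ m) (s.nonneg i))
  have h2 := Nat.floor_le (mul_nonneg (by positivity : (0:ℝ) ≤ 2 ^ m) (t.nonneg i))
  have h3 := Nat.lt_floor_add_one ((2:ℝ) ^ m * s.1 i)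
  have h4 := Nat.lt_floor_add_one ((2:ℝ) ^ m * t.1 i)
  rw [abs_le] at ha ⊢
  have h5 : (⌊(2:ℝ) ^ m * s.1 i⌋₊ : ℝ) < ⌊(2:ℝ) ^ m * t.1 i⌋₊ + 2 := by linarith [ha.2]
  have h6 : (⌊(2:ℝ) ^ m * t.1 i⌋₊ : ℝ) < ⌊(2:ℝ) ^ m * s.1 i⌋₊ + 2 := by linarith [ha.1]
  have h5' : ⌊(2:ℝ) ^ m * s.1 i⌋₊ ≤ ⌊(2:ℝ) ^ m * t.1 i⌋₊ + 1 := by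
    have : ⌊(2:ℝ) ^ m * s.1 i⌋₊ < ⌊(2:ℝ) ^ m * t.1 i⌋₊ + 2 := by exact_mod_cast h5
    omega
  have h6' : ⌊(2:ℝ) ^ m * t.1 i⌋₊ ≤ ⌊(2:ℝ) ^ m * s.1 i⌋₊ + 1 := by
    have : ⌊(2:ℝ) ^ m * t.1 i⌋₊ < ⌊(2:ℝ) ^ m * s.1 i⌋₊ + 2 := by exact_mod_cast h6
    omega
  have h5'' : (⌊(2:ℝ) ^ m * s.1 i⌋₊ : ℝ) ≤ ⌊(2:ℝ) ^ m * t.1 i⌋₊ + 1 := by exact_mod_cast h5'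
  have h6'' : (⌊(2:ℝ) ^ m * t.1 i⌋₊ : ℝ) ≤ ⌊(2:ℝ) ^ m * s.1 i⌋₊ + 1 := by exact_mod_cast h6'
  constructor <;> linarith

theorem dist_gridFloor_le {d : ℕ} (m : ℕ) (t : Cube d) : dist (gridFloor m t) t ≤ (1 / 2) ^ m := by
  rw [Cube.dist_le_iff (by positivity)]
  intro i
  have h2 := Nat.floor_le (mul_nonneg (by positivity : (0:ℝ) ≤ 2 ^ m) (t.nonneg i))
  have h4 := Nat.lt_floor_add_one ((2:ℝ) ^ m * t.1 i)
  have e : (gridFloor m t).1 i - t.1 i = (⌊2 ^ m * t.1 i⌋₊ - 2 ^ m * t.1 i) * (1 / 2) ^ m := by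
    rw [gridFloor_apply, one_div, inv_pow]
    field_simp
  rw [e, abs_mul, abs_of_pos (by positivity : (0:ℝ) < (1 / 2) ^ m)]
  refine mul_le_of_le_one_left (by positivity) ?_
  rw [abs_le]
  constructor <;> linarith

theorem tendsto_gridFloor {d : ℕ} (t : Cube d) :
    Tendsto (fun m => gridFloor m t) atTop (𝓝 t) := by
  rw [tendsto_iff_dist_tendsto_zero]
  exact squeeze_zero (fun _ => dist_nonneg) (fun m => dist_gridFloor_le m t)
    (tendsto_pow_atTop_nhds_zero_of_lt_one (by norm_num) (by norm_num))

/-- The grids are nested, so passing from the floor of level `m` to that of level `m + 1` is an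
increment inside the finer grid. -/
theorem exists_gridPt_succ_eq {d : ℕ} (m : ℕ) (k : Fin d → Fin (2 ^ m + 1)) :
    ∃ k', gridPt (m + 1) k' = gridPt m k := by
  refine ⟨fun i => ⟨2 * (k i : ℕ), ?_⟩, ?_⟩
  · have := (k i).2
    rw [pow_succ]
    omega
  · ext i
    simp only [gridPt]
    push_cast
    rw [pow_succ]
    field_simp

theorem dist_gridFloor_succ_le {d : ℕ} (m : ℕ) (t : Cube d) :
    dist (gridFloor m t) (gridFloor (m + 1) t) ≤ (1 / 2) ^ (m + 1) := by
  rw [Cube.dist_le_iff (by positivity)]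
  intro i
  rw [gridFloor_apply, gridFloor_apply]
  set x := (2:ℝ) ^ m * t.1 i with hx
  have hx2 : (2:ℝ) ^ (m + 1) * t.1 i = 2 * x := by rw [hx, pow_succ]; ring
  rw [hx2]
  have hx0 : 0 ≤ x := mul_nonneg (by positivity) (t.nonneg i)
  have h1 := Nat.floor_le hx0
  have h2 := Nat.lt_floor_add_one x
  have h3 : 2 * ⌊x⌋₊ ≤ ⌊2 * x⌋₊ := Nat.le_floor (by push_cast; linarith)
  have h4 : ⌊2 * x⌋₊ < 2 * ⌊x⌋₊ + 2 := (Nat.floor_lt (by positivity)).2 (by push_cast; linarith)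
  have h5 : ⌊2 * x⌋₊ ≤ 2 * ⌊x⌋₊ + 1 := by omega
  have h3' : (2:ℝ) * ⌊x⌋₊ ≤ ⌊2 * x⌋₊ := by exact_mod_cast h3
  have h5' : (⌊2 * x⌋₊ : ℝ) ≤ 2 * ⌊x⌋₊ + 1 := by exact_mod_cast h5
  have e : (⌊x⌋₊ : ℝ) / 2 ^ m - ⌊2 * x⌋₊ / 2 ^ (m + 1) =
      (2 * ⌊x⌋₊ - ⌊2 * x⌋₊) * (1 / 2) ^ (m + 1) := by
    rw [one_div, inv_pow, pow_succ]
    field_simp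
  rw [e, abs_mul, abs_of_pos (by positivity : (0:ℝ) < (1 / 2) ^ (m + 1))]
  refine mul_le_of_le_one_left (by positivity) ?_
  rw [abs_le]
  constructor <;> linarith

theorem continuous_of_dyadic_modulus {d : ℕ} {f : Cube d → ℝ} {A r : ℝ} (hr0 : 0 ≤ r) (hr1 : r < 1)
    (hf : ∀ m s t, dist s t ≤ (1 / 2) ^ m → |f s - f t| ≤ A * r ^ m) : Continuous f := by
  rw [Metric.continuous_iff]
  intro t ε hε
  have h0 : Tendsto (fun m => A * r ^ m) atTop (𝓝 (A * 0)) :=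
    (tendsto_pow_atTop_nhds_zero_of_lt_one hr0 hr1).const_mul A
  rw [mul_zero] at h0
  obtain ⟨m, hm⟩ := (h0.eventually_lt_const hε).exists
  exact ⟨(1 / 2) ^ m, by positivity, fun s hs => (hf m s t hs.le).trans_lt hm⟩

/-- Chaining: a function whose increments over adjacent points of the dyadic grids decay
geometrically has a continuous version with a geometric modulus of continuity. -/
theorem exists_continuousMap_of_grid_increments {d : ℕ} {F : Cube d → ℝ} {A r : ℝ}
    (hr0 : 0 ≤ r) (hr1 : r < 1)
    (hF : ∀ m k k', dist (gridPt m k : Cube d) (gridPt m k') ≤ (1 / 2) ^ m →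
      |F (gridPt m k) - F (gridPt m k')| ≤ A * r ^ m) :
    ∃ g : C(Cube d, ℝ), (∀ t, Tendsto (fun m => F (gridFloor m t)) atTop (𝓝 (g t))) ∧
      ∀ m s t, dist s t ≤ (1 / 2) ^ m → |g s - g t| ≤ A * (1 + 2 * r / (1 - r)) * r ^ m := by
  have hstep : ∀ t m, dist (F (gridFloor m t)) (F (gridFloor (m + 1) t)) ≤ A * r * r ^ m := by
    intro t m
    obtain ⟨k', hk'⟩ := exists_gridPt_succ_eq m (gridIdx m t)
    have h1 : gridFloor m t = gridPt (m + 1) k' := hk'.symm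
    have := hF (m + 1) k' (gridIdx (m + 1) t) (by
      rw [← h1]; exact dist_gridFloor_succ_le m t)
    rw [Real.dist_eq, h1]
    refine this.trans (le_of_eq ?_)
    ring
  have hlim : ∀ t, ∃ x, Tendsto (fun m => F (gridFloor m t)) atTop (𝓝 x) := fun t =>
    cauchySeq_tendsto_of_complete (cauchySeq_of_le_geometric r (A * r) hr1 (hstep t))
  choose g hg using hlim
  -- The path goes from `s` to its floor, crosses once between the two floors, and returns to `t`:
  -- the crossing costs `A * r ^ m` and each of the two geometric tails `A * r / (1 - r) * r ^ m`.
  have hmod : ∀ m s t, dist s t ≤ (1 / 2) ^ m →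
      |g s - g t| ≤ A * (1 + 2 * r / (1 - r)) * r ^ m := by
    intro m s t hst
    have h1 := dist_le_of_le_geometric_of_tendsto r (A * r) hr1 (hstep s) (hg s) m
    have h2 := dist_le_of_le_geometric_of_tendsto r (A * r) hr1 (hstep t) (hg t) m
    have h3 := hF m _ _ (dist_gridFloor_gridFloor_le hst)
    have h4 : dist (g s) (g t) ≤ dist (F (gridFloor m s)) (g s) +
        dist (F (gridFloor m s)) (F (gridFloor m t)) + dist (F (gridFloor m t)) (g t) := by
      rw [dist_comm (F (gridFloor m s)) (g s)]
      exact dist_triangle4 _ _ _ _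
    rw [← Real.dist_eq]
    refine (h4.trans (add_le_add (add_le_add h1 h3) h2)).trans (le_of_eq ?_)
    have : 1 - r ≠ 0 := by linarith
    field_simp
    ring
  exact ⟨⟨g, continuous_of_dyadic_modulus hr0 hr1 hmod⟩, hg, hmod⟩

/-! ### Compactness, tightness and continuous modifications from moments -/

/-- Continuous functions on the cube, vanishing at the origin, with a given dyadic modulus. -/
def modulusSet (d : ℕ) (A r : ℝ) : Set C(Cube d, ℝ) :=
  {f | (∀ z : Cube d, z.1 = 0 → f z = 0) ∧
    ∀ m s t, dist s t ≤ (1 / 2) ^ m → |f s - f t| ≤ A * r ^ m}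

/-- Arzelà–Ascoli. The common modulus gives equicontinuity; its case `m = 0`, with the value `0` at
the origin, bounds all values by `|A|`, since the cube has sup-diameter at most `1`. -/
theorem isCompact_modulusSet (d : ℕ) {A r : ℝ} (hr0 : 0 ≤ r) (hr1 : r < 1) :
    IsCompact (modulusSet d A r) := by
  have hclosed : IsClosed (modulusSet d A r) := by
    simp only [modulusSet, Set.ofPred_and, Set.ofPred_forall]
    refine IsClosed.inter ?_ ?_
    · refine isClosed_iInter fun z => isClosed_iInter fun _ => ?_
      exact isClosed_eq (continuous_eval_const z) continuous_const
    · refine isClosed_iInter fun m => isClosed_iInter fun s => isClosed_iInter fun t =>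
        isClosed_iInter fun _ => isClosed_le ?_ continuous_const
      exact ((continuous_eval_const s).sub (continuous_eval_const t)).abs
  let e := ContinuousMap.isometryEquivBoundedOfCompact (Cube d) ℝ
  have hc : IsCompact (e '' modulusSet d A r) := by
    rw [← (show IsClosed (e '' modulusSet d A r) from
      e.toHomeomorph.isClosed_image.2 hclosed).closure_eq]
    refine BoundedContinuousFunction.arzela_ascoli (Metric.closedBall 0 |A|)
      (isCompact_closedBall _ _) _ ?_ ?_
    · rintro _ x ⟨f, hf, rfl⟩
      have hz : (0 : Fin d → ℝ) ∈ Set.Icc (0 : Fin d → ℝ) 1 := ⟨le_rfl, zero_le_one⟩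
      have h0 := hf.1 ⟨0, hz⟩ rfl
      have h1 := hf.2 0 x ⟨0, hz⟩ (by
        rw [Cube.dist_le_iff (by positivity)]
        intro i
        simp only [Pi.zero_apply, sub_zero, pow_zero]
        rw [abs_of_nonneg (x.nonneg i)]
        exact x.le_one i)
      rw [h0, sub_zero, pow_zero, mul_one] at h1
      rw [mem_closedBall_zero_iff]
      exact h1.trans (le_abs_self A)
    · intro t
      rw [Metric.equicontinuousAt_iff]
      intro ε hε
      have h0 : Tendsto (fun m => A * r ^ m) atTop (𝓝 (A * 0)) :=
        (tendsto_pow_atTop_nhds_zero_of_lt_one hr0 hr1).const_mul A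
      rw [mul_zero] at h0
      obtain ⟨m, hm⟩ := (h0.eventually_lt_const hε).exists
      refine ⟨(1 / 2) ^ m, by positivity, fun s hs ⟨_, f, hf, rfl⟩ => ?_⟩
      rw [dist_comm] at hs
      exact (hf.2 m t s hs.le).trans_lt hm
  exact (e.toHomeomorph.isCompact_image).1 hc

/-- The weighted sum of the powers of all increments over adjacent points of the dyadic grids. -/
noncomputable def gridEnergy {d : ℕ} (q : ℕ) (F : Cube d → ℝ) : ENNReal :=
  ∑' m : ℕ, ∑ p : (Fin d → Fin (2 ^ m + 1)) × (Fin d → Fin (2 ^ m + 1)),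
    if dist (gridPt m p.1) (gridPt m p.2) ≤ (1 / 2) ^ m then
      2 ^ m * ENNReal.ofReal (|F (gridPt m p.1) - F (gridPt m p.2)| ^ q) else 0

/-- A single term is at most the whole energy, and the choice `r = 2 ^ (-1/q)` turns the weight `2 ^
m` into the factor `r ^ m` after taking `q`-th roots. -/
theorem grid_increment_le_of_gridEnergy_le {d q : ℕ} (hq : q ≠ 0) {F : Cube d → ℝ} {A r : ℝ}
    (hA : 0 ≤ A) (hr : 0 ≤ r) (hrq : r ^ q = 1 / 2)
    (hF : gridEnergy q F ≤ ENNReal.ofReal (A ^ q)) (m : ℕ) (k k' : Fin d → Fin (2 ^ m + 1))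
    (hk : dist (gridPt m k) (gridPt m k') ≤ (1 / 2) ^ m) :
    |F (gridPt m k) - F (gridPt m k')| ≤ A * r ^ m := by
  have h1 : 2 ^ m * ENNReal.ofReal (|F (gridPt m k) - F (gridPt m k')| ^ q) ≤
      ENNReal.ofReal (A ^ q) := by
    refine le_trans ?_ ((ENNReal.le_tsum m).trans hF)
    refine le_trans ?_ (Finset.single_le_sum (fun _ _ => zero_le) (Finset.mem_univ (k, k')))
    simp only [if_pos hk, le_refl]
  rw [show (2 : ENNReal) ^ m = ENNReal.ofReal (2 ^ m) by
      rw [ENNReal.ofReal_pow (by norm_num)]; norm_num,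
    ← ENNReal.ofReal_mul (by positivity), ENNReal.ofReal_le_ofReal_iff (by positivity)] at h1
  refine le_of_pow_le_pow_left₀ hq (by positivity) ?_
  rw [mul_pow, ← pow_mul, mul_comm m q, pow_mul, hrq, one_div, inv_pow, ← div_eq_mul_inv,
    le_div_iff₀ (by positivity)]
  linarith

theorem aemeasurable_gridEnergy {d q : ℕ} {Ω : Type*} [MeasurableSpace Ω] {P : Measure Ω}
    {X : Cube d → Ω → ℝ} (hX : ∀ t, AEMeasurable (X t) P) :
    AEMeasurable (fun ω => gridEnergy q fun t => X t ω) P := by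
  refine AEMeasurable.tsum fun m => Finset.aemeasurable_fun_sum _ fun p _ => ?_
  split_ifs
  · exact (((hX _).sub (hX _)).norm.pow_const q).ennreal_ofReal.const_mul _
  · exact aemeasurable_const

/-- Counting all pairs of grid points, not just adjacent ones, gives at most `4 ^ d * (4 ^ d) ^ m`
of them. The rate `4 ^ (-(d + 1) m)` beats this number together with the weight `2 ^ m` and leaves a
geometric series of ratio `1/2`. -/
theorem lintegral_gridEnergy_le {d q : ℕ} {Ω : Type*} [MeasurableSpace Ω] {P : Measure Ω}
    {X : Cube d → Ω → ℝ} (hX : ∀ t, AEMeasurable (X t) P) {M : ENNReal}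
    (hM : ∀ (m : ℕ) (s t : Cube d), dist s t ≤ (1 / 2) ^ m →
      ∫⁻ ω, ENNReal.ofReal (|X s ω - X t ω| ^ q) ∂P ≤ M * ((4 ^ (d + 1)) ^ m)⁻¹) :
    ∫⁻ ω, gridEnergy q (fun t => X t ω) ∂P ≤ 2 * 4 ^ d * M := by
  have hmeas : ∀ s t, AEMeasurable (fun ω => ENNReal.ofReal (|X s ω - X t ω| ^ q)) P :=
    fun s t => (((hX s).sub (hX t)).norm.pow_const q).ennreal_ofReal
  have hmeas' : ∀ (m : ℕ) (p : (Fin d → Fin (2 ^ m + 1)) × (Fin d → Fin (2 ^ m + 1))),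
      AEMeasurable (fun ω => if dist (gridPt m p.1) (gridPt m p.2) ≤ (1 / 2) ^ m then
        2 ^ m * ENNReal.ofReal (|X (gridPt m p.1) ω - X (gridPt m p.2) ω| ^ q) else 0) P := by
    intro m p
    split_ifs
    · exact (hmeas _ _).const_mul _
    · exact aemeasurable_const
  unfold gridEnergy
  rw [lintegral_tsum fun m => Finset.aemeasurable_fun_sum _ fun p _ => hmeas' m p]
  calc _ ≤ ∑' m : ℕ, 4 ^ d * M * 2⁻¹ ^ m := by
        refine ENNReal.tsum_le_tsum fun m => ?_
        rw [lintegral_finsetSum' _ fun p _ => hmeas' m p]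
        calc _ ≤ ∑ p : (Fin d → Fin (2 ^ m + 1)) × (Fin d → Fin (2 ^ m + 1)),
              2 ^ m * (M * ((4 ^ (d + 1)) ^ m)⁻¹) := by
              refine Finset.sum_le_sum fun p _ => ?_
              split_ifs with h
              · rw [lintegral_const_mul'' _ (hmeas _ _)]
                gcongr
                exact hM m _ _ h
              · simp
          _ ≤ (4 ^ d * (4 ^ d) ^ m : ENNReal) * (2 ^ m * (M * ((4 ^ (d + 1)) ^ m)⁻¹)) := by
              rw [Finset.sum_const, nsmul_eq_mul]
              gcongr
              simp only [Finset.card_univ, Fintype.card_prod, Fintype.card_pi, Fintype.card_fin,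
                Finset.prod_const]
              have : (2 ^ m + 1) ^ d * (2 ^ m + 1) ^ d ≤ 4 ^ d * (4 ^ d) ^ m := by
                calc (2 ^ m + 1) ^ d * (2 ^ m + 1) ^ d ≤ (2 ^ (m + 1)) ^ d * (2 ^ (m + 1)) ^ d := by
                      have : 2 ^ m + 1 ≤ 2 ^ (m + 1) := by
                        rw [pow_succ]; linarith [Nat.one_le_two_pow (n := m)]
                      gcongr
                  _ = 4 ^ d * (4 ^ d) ^ m := by
                    rw [← mul_pow, ← mul_pow, ← pow_mul, ← pow_mul, ← pow_add]
                    norm_num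
                    ring
              exact_mod_cast this
          _ = 4 ^ d * M * ((4 ^ d) ^ m * 2 ^ m * ((4 ^ (d + 1)) ^ m)⁻¹) := by ring
          _ = 4 ^ d * M * 2⁻¹ ^ m := by
              congr 1
              rw [← mul_pow, ENNReal.inv_pow, ← mul_pow]
              congr 1
              rw [show (4 : ENNReal) ^ (d + 1) = (4 ^ d * 2) * 2 by rw [pow_succ, mul_assoc]; norm_num,
                ENNReal.mul_inv (by simp) (by simp), ← mul_assoc,
                ENNReal.mul_inv_cancel (by simp) (by finiteness), one_mul]
    _ = 2 * 4 ^ d * M := by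
        rw [ENNReal.tsum_mul_left, ENNReal.tsum_geometric, ENNReal.one_sub_inv_two, inv_inv]
        ring

theorem exists_pow_eq_half {q : ℕ} (hq : q ≠ 0) : ∃ r : ℝ, 0 ≤ r ∧ r < 1 ∧ r ^ q = 1 / 2 := by
  refine ⟨(1 / 2 : ℝ) ^ (1 / (q : ℝ)), by positivity,
    Real.rpow_lt_one (by norm_num) (by norm_num) (by positivity), ?_⟩
  rw [← Real.rpow_natCast, ← Real.rpow_mul (by norm_num), one_div_mul_cancel (by positivity),
    Real.rpow_one]

instance instPolishSpaceCube (d : ℕ) : PolishSpace C(Cube d, ℝ) := inferInstance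

/-- Evaluation along a dense sequence is a continuous injection between Polish spaces, hence a
measurable embedding (Lusin–Souslin). It reduces measurability of `C([0,1]ᵈ)`-valued maps to that of
their point values. -/
theorem exists_measurableEmbedding_eval (d : ℕ) : ∃ τ : ℕ → Cube d,
    MeasurableEmbedding (fun (f : C(Cube d, ℝ)) (n : ℕ) => f (τ n)) := by
  have : Nonempty (Cube d) := ⟨⟨0, le_rfl, zero_le_one⟩⟩
  refine ⟨TopologicalSpace.denseSeq (Cube d), Continuous.measurableEmbedding ?_ ?_⟩
  · exact continuous_pi fun n => continuous_eval_const _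
  · intro f g hfg
    refine ContinuousMap.coe_injective ?_
    exact (TopologicalSpace.denseRange_denseSeq (Cube d)).equalizer f.continuous g.continuous hfg

theorem aemeasurable_continuousMap {d : ℕ} {Ω : Type*} [MeasurableSpace Ω] {P : Measure Ω}
    {X : Ω → C(Cube d, ℝ)} (hX : ∀ t, AEMeasurable (fun ω => X ω t) P) : AEMeasurable X P := by
  obtain ⟨τ, hτ⟩ := exists_measurableEmbedding_eval d
  rw [← hτ.aemeasurable_comp_iff]
  exact aemeasurable_pi_lambda _ fun n => hX (τ n)

/-- A moment criterion for tightness of laws on `C([0,1]ᵈ)`. -/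
theorem isTightMeasureSet_of_moments {d q : ℕ} (hq : q ≠ 0) {ι Ω : Type*} [MeasurableSpace Ω]
    {P : Measure Ω} {Y : ι → Ω → C(Cube d, ℝ)}
    (hY : ∀ n t, AEMeasurable (fun ω => Y n ω t) P)
    (hY0 : ∀ n ω (z : Cube d), z.1 = 0 → Y n ω z = 0) {M : ENNReal} (hMtop : M ≠ ⊤)
    (hM : ∀ n (m : ℕ) (s t : Cube d), dist s t ≤ (1 / 2) ^ m →
      ∫⁻ ω, ENNReal.ofReal (|Y n ω s - Y n ω t| ^ q) ∂P ≤ M * ((4 ^ (d + 1)) ^ m)⁻¹) :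
    IsTightMeasureSet {P.map (Y n) | n} := by
  rw [isTightMeasureSet_iff_exists_isCompact_measure_compl_le]
  intro ε hε
  obtain ⟨r, hr0, hr1, hrq⟩ := exists_pow_eq_half hq
  set B : ENNReal := 2 * 4 ^ d * M with hB
  have hBtop : B ≠ ⊤ := by finiteness
  -- Markov's inequality will bound the exceptional probability by `B / A ^ q`; taking `A = N + 1 ≥
  -- 1` gives `A ≤ A ^ q`, so this is at most `ε`.
  obtain ⟨N, hN⟩ : ∃ N : ℕ, B / ε ≤ (N + 1 : ℕ) := by
    obtain ⟨N, hN⟩ := ENNReal.exists_nat_gt (ENNReal.div_lt_top hBtop hε.ne').ne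
    exact ⟨N, hN.le.trans (by exact_mod_cast N.le_succ)⟩
  set A : ℝ := ((N + 1 : ℕ) : ℝ) with hA
  have hA1 : (1 : ℝ) ≤ A := by rw [hA]; push_cast; linarith [Nat.cast_nonneg (α := ℝ) N]
  have hA0 : 0 ≤ A := by linarith
  refine ⟨modulusSet d (A * (1 + 2 * r / (1 - r))) r, isCompact_modulusSet d hr0 hr1, ?_⟩
  rintro _ ⟨n, rfl⟩
  rw [Measure.map_apply_of_aemeasurable (aemeasurable_continuousMap (hY n))
    (isCompact_modulusSet d hr0 hr1).isClosed.measurableSet.compl]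
  have hsub : Y n ⁻¹' (modulusSet d (A * (1 + 2 * r / (1 - r))) r)ᶜ ⊆
      {ω | ENNReal.ofReal (A ^ q) ≤ gridEnergy q fun t => Y n ω t} := by
    intro ω hω
    by_contra hcon
    apply hω
    have hcon' : gridEnergy q (fun t => Y n ω t) ≤ ENNReal.ofReal (A ^ q) := by
      simpa using (not_le.1 hcon).le
    obtain ⟨g, hg, hg'⟩ := exists_continuousMap_of_grid_increments hr0 hr1
      (grid_increment_le_of_gridEnergy_le hq hA0 hr0 hrq hcon')
    have : g = Y n ω := by
      ext t
      exact tendsto_nhds_unique (hg t) (((Y n ω).continuous.tendsto t).comp (tendsto_gridFloor t))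
    rw [this] at hg'
    exact ⟨hY0 n ω, hg'⟩
  have hAq : ENNReal.ofReal (A ^ q) ≠ 0 := by
    rw [ne_eq, ENNReal.ofReal_eq_zero, not_le]; positivity
  calc P (Y n ⁻¹' _) ≤ P {ω | ENNReal.ofReal (A ^ q) ≤ gridEnergy q fun t => Y n ω t} :=
        measure_mono hsub
    _ ≤ (∫⁻ ω, gridEnergy q (fun t => Y n ω t) ∂P) / ENNReal.ofReal (A ^ q) :=
        meas_ge_le_lintegral_div (aemeasurable_gridEnergy (hY n)) hAq ENNReal.ofReal_ne_top
    _ ≤ B / ENNReal.ofReal (A ^ q) := by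
        gcongr
        exact lintegral_gridEnergy_le (X := fun t ω => Y n ω t) (hY n) (hM n)
    _ ≤ ε := by
        refine ENNReal.div_le_of_le_mul' ?_
        rw [ENNReal.div_le_iff_le_mul (Or.inl hε.ne') (Or.inr (by simp))] at hN
        refine hN.trans ?_
        gcongr
        calc ((N + 1 : ℕ) : ENNReal) = ENNReal.ofReal A := (ENNReal.ofReal_natCast _).symm
          _ ≤ ENNReal.ofReal (A ^ q) := ENNReal.ofReal_le_ofReal (le_self_pow₀ hA1 hq)

/-- The Kolmogorov continuity criterion on the unit cube. -/
theorem exists_continuous_modification {d q : ℕ} (hq : q ≠ 0) {Ω : Type*} [MeasurableSpace Ω]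
    {P : Measure Ω} {X : Cube d → Ω → ℝ} (hX : ∀ t, AEMeasurable (X t) P)
    {M : ENNReal} (hMtop : M ≠ ⊤)
    (hM : ∀ (m : ℕ) (s t : Cube d), dist s t ≤ (1 / 2) ^ m →
      ∫⁻ ω, ENNReal.ofReal (|X s ω - X t ω| ^ q) ∂P ≤ M * ((4 ^ (d + 1)) ^ m)⁻¹) :
    ∃ Y : Ω → C(Cube d, ℝ), ∀ t, ∀ᵐ ω ∂P, Y ω t = X t ω := by
  classical
  obtain ⟨r, hr0, hr1, hrq⟩ := exists_pow_eq_half hq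
  have hfin : ∀ᵐ ω ∂P, gridEnergy q (fun t => X t ω) < ⊤ := by
    refine ae_lt_top' (aemeasurable_gridEnergy hX) ?_
    exact ((lintegral_gridEnergy_le hX hM).trans_lt (by finiteness)).ne
  have hex : ∀ ω, gridEnergy q (fun t => X t ω) < ⊤ → ∃ g : C(Cube d, ℝ),
      ∀ t, Tendsto (fun m => X (gridFloor m t) ω) atTop (𝓝 (g t)) := by
    intro ω hω
    obtain ⟨N, hN⟩ := ENNReal.exists_nat_gt hω.ne
    have hA1 : (1 : ℝ) ≤ (N + 1 : ℕ) := by push_cast; linarith [Nat.cast_nonneg (α := ℝ) N]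
    have hle : gridEnergy q (fun t => X t ω) ≤ ENNReal.ofReal (((N + 1 : ℕ) : ℝ) ^ q) := by
      refine hN.le.trans ?_
      calc (N : ENNReal) = ENNReal.ofReal N := by simp
        _ ≤ _ := by
          refine ENNReal.ofReal_le_ofReal ?_
          calc (N : ℝ) ≤ (N + 1 : ℕ) := by push_cast; linarith
            _ ≤ _ := le_self_pow₀ hA1 hq
    obtain ⟨g, hg, -⟩ := exists_continuousMap_of_grid_increments hr0 hr1
      (grid_increment_le_of_gridEnergy_le hq (by positivity) hr0 hrq hle)
    exact ⟨g, hg⟩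
  choose g hg using hex
  refine ⟨fun ω => if h : gridEnergy q (fun t => X t ω) < ⊤ then g ω h else 0, fun t => ?_⟩
  have hmeas : ∀ m, AEMeasurable
      (fun ω => ENNReal.ofReal (|X (gridFloor m t) ω - X t ω| ^ q)) P :=
    fun m => (((hX _).sub (hX _)).norm.pow_const q).ennreal_ofReal
  -- Finite energy controls grid points only. Summability of these moments forces `X (gridFloor m
  -- t)` to converge almost surely to `X t`, which identifies the limit at a non-dyadic `t`.
  have hsum : ∀ᵐ ω ∂P, ∑' m, ENNReal.ofReal (|X (gridFloor m t) ω - X t ω| ^ q) < ⊤ := by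
    refine ae_lt_top' (AEMeasurable.tsum hmeas) ?_
    rw [lintegral_tsum hmeas]
    refine ((ENNReal.tsum_le_tsum fun m => hM m _ _ (dist_gridFloor_le m t)).trans_lt ?_).ne
    rw [ENNReal.tsum_mul_left]
    refine ENNReal.mul_lt_top hMtop.lt_top ?_
    simp_rw [ENNReal.inv_pow]
    rw [ENNReal.tsum_geometric]
    refine ENNReal.inv_lt_top.2 (tsub_pos_of_lt ?_)
    refine pow_lt_one₀ zero_le ?_ (by simp)
    rw [ENNReal.inv_lt_one]
    norm_num
  filter_upwards [hfin, hsum] with ω h1 h2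
  rw [dif_pos h1]
  refine tendsto_nhds_unique (hg ω h1 t) ?_
  have h3 := ENNReal.tendsto_atTop_zero_of_tsum_ne_top h2.ne
  have h4 : Tendsto (fun m => |X (gridFloor m t) ω - X t ω| ^ q) atTop (𝓝 0) := by
    have := (ENNReal.tendsto_toReal ENNReal.zero_ne_top).comp h3
    refine (this.congr fun m => ?_)
    simp only [Function.comp]
    rw [ENNReal.toReal_ofReal (by positivity)]
  rw [tendsto_iff_dist_tendsto_zero]
  have h5 := h4.rpow_const (p := 1 / (q : ℝ)) (Or.inr (by positivity))
  rw [Real.zero_rpow (by positivity)] at h5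
  refine h5.congr fun m => ?_
  rw [← Real.rpow_natCast, ← Real.rpow_mul (abs_nonneg _), mul_one_div_cancel (by positivity),
    Real.rpow_one, Real.dist_eq]

/-! ### Weak convergence from tightness and finite-dimensional characteristic functions -/

/-- The pairing of continuous functions with finitely supported signed measures on the cube. -/
noncomputable def evalPairing (d : ℕ) : C(Cube d, ℝ) →ₗ[ℝ] (Cube d →₀ ℝ) →ₗ[ℝ] ℝ :=
  LinearMap.mk₂ ℝ (fun f c => c.sum fun t a => a * f t)
    (fun f g c => by simp [Finsupp.sum, mul_add, Finset.sum_add_distrib])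
    (fun x f c => by simp [Finsupp.sum, Finset.mul_sum, mul_left_comm])
    (fun f c c' => by
      rw [Finsupp.sum_add_index'] <;> simp [add_mul])
    (fun x f c => by
      rw [Finsupp.sum_smul_index (by simp)]
      simp [Finsupp.sum, Finset.mul_sum, mul_assoc])

theorem evalPairing_apply {d : ℕ} (f : C(Cube d, ℝ)) (c : Cube d →₀ ℝ) :
    evalPairing d f c = c.sum fun t a => a * f t := rfl

theorem continuous_evalPairing {d : ℕ} (c : Cube d →₀ ℝ) :
    Continuous fun f => evalPairing d f c := by
  simp only [evalPairing_apply, Finsupp.sum]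
  exact continuous_finsetSum _ fun t _ => (continuous_eval_const t).const_mul _

theorem integral_probChar_evalPairing {d : ℕ} {Ω : Type*} [MeasurableSpace Ω] {P : Measure Ω}
    {V : Ω → C(Cube d, ℝ)} (hV : AEMeasurable V P) (c : Cube d →₀ ℝ) :
    ∫ x, (Real.probChar (evalPairing d x c) : ℂ) ∂(P.map V) =
      charFun (P.map fun ω => c.sum fun t a => a * V ω t) 1 := by
  have h1 : (P.map fun ω => c.sum fun t a => a * V ω t) =
      (P.map V).map fun f => evalPairing d f c := by
    rw [AEMeasurable.map_map_of_aemeasurable (continuous_evalPairing c).aemeasurable hV]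
    rfl
  rw [h1, charFun_apply_real, integral_map (continuous_evalPairing c).aemeasurable (by fun_prop)]
  simp [Real.probChar_apply]

/-- Tightness and convergence of the finite-dimensional characteristic functions imply convergence
in distribution in `C([0,1]ᵈ)`. -/
theorem tendstoInDistribution_of_isTightMeasureSet {d : ℕ} {Ω Ω' : Type*} [MeasurableSpace Ω]
    [MeasurableSpace Ω'] {P : Measure Ω} [IsProbabilityMeasure P] {P' : Measure Ω'}
    [IsProbabilityMeasure P'] {Y : ℕ → Ω → C(Cube d, ℝ)} {X : Ω' → C(Cube d, ℝ)}
    (hY : ∀ n t, AEMeasurable (fun ω => Y n ω t) P) (hX : ∀ t, AEMeasurable (fun ω => X ω t) P')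
    (htight : IsTightMeasureSet {P.map (Y n) | n})
    (hchar : ∀ c : Cube d →₀ ℝ,
      Tendsto (fun n => charFun (P.map fun ω => c.sum fun t a => a * Y n ω t) 1) atTop
        (𝓝 (charFun (P'.map fun ω => c.sum fun t a => a * X ω t) 1))) :
    TendstoInDistribution Y atTop X (fun _ => P) P' := by
  have hYm := fun n => aemeasurable_continuousMap (hY n)
  have hXm := aemeasurable_continuousMap hX
  refine ⟨hYm, hXm, ?_⟩
  -- With the discrete topology on the finitely supported measures, joint continuity of the pairing
  -- reduces to continuity in the function alone. The exponentials of the pairing then generate a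
  -- separating algebra, the point masses already detecting a nonzero function.
  let : TopologicalSpace (Cube d →₀ ℝ) := ⊥
  have : DiscreteTopology (Cube d →₀ ℝ) := ⟨rfl⟩
  have hL : Continuous fun p : C(Cube d, ℝ) × (Cube d →₀ ℝ) => evalPairing d p.1 p.2 :=
    continuous_prod_of_discrete_right.2 continuous_evalPairing
  refine ProbabilityMeasure.tendsto_of_tight_of_separatesPoints ℂ (by simpa using htight)
    (A := BoundedContinuousFunction.charPoly Real.continuous_probChar hL)
    (BoundedContinuousFunction.separatesPoints_charPoly _ Real.probChar_ne_one _ ?_) ?_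
  · intro f hf h0
    obtain ⟨t, ht⟩ := DFunLike.ne_iff.1 hf
    have := LinearMap.congr_fun h0 (Finsupp.single t 1)
    rw [evalPairing_apply] at this
    simp only [zero_mul, Finsupp.sum_single_index, one_mul, LinearMap.zero_apply] at this
    exact ht this
  · intro g hg
    rw [BoundedContinuousFunction.mem_charPoly] at hg
    obtain ⟨w, hw⟩ := hg
    have hint : ∀ (μ : Measure C(Cube d, ℝ)), IsProbabilityMeasure μ → ∀ c : Cube d →₀ ℝ,
        Integrable (fun x => (Real.probChar (evalPairing d x c) : ℂ)) μ := fun μ hμ c =>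
      BoundedContinuousFunction.integrable μ
        (BoundedContinuousFunction.char Real.continuous_probChar hL c)
    have h_eq : ∀ (μ : Measure C(Cube d, ℝ)), IsProbabilityMeasure μ → ∫ x, g x ∂μ =
        w.coeff.sum (fun a z => z * ∫ x, (Real.probChar (evalPairing d x a) : ℂ) ∂μ) := by
      intro μ hμ
      simp_rw [hw, Finsupp.sum]
      rw [integral_finsetSum _ fun i _ => (hint μ hμ i).const_mul _]
      simp_rw [integral_const_mul]
    have key : ∀ c : Cube d →₀ ℝ, Tendsto
        (fun n => ∫ x, (Real.probChar (evalPairing d x c) : ℂ) ∂(P.map (Y n))) atTop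
        (𝓝 (∫ x, (Real.probChar (evalPairing d x c) : ℂ) ∂(P'.map X))) := by
      intro c
      rw [integral_probChar_evalPairing hXm]
      exact (hchar c).congr fun n => (integral_probChar_evalPairing (hYm n) c).symm
    have hfin := fun n => h_eq (P.map (Y n)) (Measure.isProbabilityMeasure_map (hYm n))
    have hfin' := h_eq (P'.map X) (Measure.isProbabilityMeasure_map hXm)
    simp only [ProbabilityMeasure.coe_mk]
    simp_rw [hfin, hfin']
    exact tendsto_finsetSum _ fun c _ => (key c).const_mul _

/-! ### One-dimensional kernel estimates -/

theorem abs_exp_sub_exp_le (x y : ℝ) :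
    |Real.exp x - Real.exp y| ≤ |x - y| * max (Real.exp x) (Real.exp y) := by
  wlog h : y ≤ x generalizing x y
  · rw [abs_sub_comm, abs_sub_comm x y, max_comm]
    exact this y x (le_of_not_ge h)
  rw [max_eq_left (Real.exp_le_exp.2 h), abs_of_nonneg (sub_nonneg.2 (Real.exp_le_exp.2 h)),
    abs_of_nonneg (sub_nonneg.2 h)]
  have h1 := Real.add_one_le_exp (y - x)
  have h2 : Real.exp y = Real.exp x * Real.exp (y - x) := by rw [← Real.exp_add]; ring_nf
  rw [h2]
  nlinarith [Real.exp_pos x]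

/-- Subadditivity of `z ↦ z ^ θ` gives `θ log (1 + z) ≤ log (1 + z ^ θ) ≤ z ^ θ`. -/
theorem log_one_add_le_rpow_div {z θ : ℝ} (hz : 0 ≤ z) (hθ : 0 < θ) (hθ1 : θ ≤ 1) :
    Real.log (1 + z) ≤ z ^ θ / θ := by
  rw [le_div_iff₀ hθ, mul_comm, ← Real.log_rpow (by linarith)]
  have h1 : (1 + z) ^ θ ≤ 1 + z ^ θ := by
    simpa using Real.rpow_add_le_add_rpow zero_le_one hz hθ.le hθ1
  calc Real.log ((1 + z) ^ θ) ≤ Real.log (1 + z ^ θ) :=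
        Real.log_le_log (by positivity) h1
    _ ≤ 1 + z ^ θ - 1 := Real.log_le_sub_one_of_pos (by positivity)
    _ = z ^ θ := by ring

/-- The base is changed first, at the cost of `log a - log b`, and then the exponent, at the cost of
`|log b|`. Each logarithm is paid for by a factor `b ^ (-κ/2)`, which worsens `b ^ (κ - 1/2)` to `b
^ ((κ - 1)/2)`; the square of the latter is still integrable at `0`. -/
theorem abs_rpow_sub_rpow_le {κ p q a b : ℝ} (hκ : 0 < κ) (hκ1 : κ ≤ 1 / 2)
    (hp : κ - 1 / 2 ≤ p) (hp' : p ≤ 1 / 2) (hq : κ - 1 / 2 ≤ q)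
    (hb : 0 < b) (hab : b ≤ a) (ha : a ≤ 1) :
    |a ^ p - b ^ q| ≤ 2 / κ * ((a - b) ^ (κ / 2) + |p - q|) * b ^ ((κ - 1) / 2) := by
  have ha0 : 0 < a := hb.trans_le hab
  have hb1 : b ≤ 1 := hab.trans ha
  have hbq : ∀ r, κ - 1 / 2 ≤ r → b ^ r ≤ b ^ (κ - 1 / 2) := fun r hr =>
    Real.rpow_le_rpow_of_exponent_ge hb hb1 hr
  have hap : a ^ p ≤ b ^ (κ - 1 / 2) :=
    (Real.rpow_le_rpow_of_exponent_ge ha0 ha hp).trans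
      (Real.rpow_le_rpow_of_nonpos hb hab (by linarith))
  have hsplit : b ^ (-(κ / 2)) * b ^ (κ - 1 / 2) = b ^ ((κ - 1) / 2) := by
    rw [← Real.rpow_add hb]; ring_nf
  have hlogab : Real.log a - Real.log b ≤ 2 / κ * (a - b) ^ (κ / 2) * b ^ (-(κ / 2)) := by
    rw [← Real.log_div ha0.ne' hb.ne']
    have h1 : a / b = 1 + (a - b) / b := by field_simp; ring
    have h2 := log_one_add_le_rpow_div (z := (a - b) / b) (θ := κ / 2)
      (div_nonneg (by linarith) hb.le) (by linarith) (by linarith)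
    rw [h1]
    refine h2.trans (le_of_eq ?_)
    rw [Real.div_rpow (by linarith) hb.le, Real.rpow_neg hb.le]
    field_simp
  have hlogb : -Real.log b ≤ 2 / κ * b ^ (-(κ / 2)) := by
    rw [← Real.log_inv]
    have h2 := Real.log_le_rpow_div (x := b⁻¹) (ε := κ / 2) (by positivity) (by linarith)
    refine h2.trans (le_of_eq ?_)
    rw [Real.inv_rpow hb.le, Real.rpow_neg hb.le]
    field_simp
  have hlogb0 : Real.log b ≤ 0 := Real.log_nonpos hb.le hb1
  have hlog0 : 0 ≤ Real.log a - Real.log b := sub_nonneg.2 (Real.log_le_log hb hab)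
  have h1 : |a ^ p - b ^ p| ≤ 2 / κ * (a - b) ^ (κ / 2) * b ^ ((κ - 1) / 2) := by
    have h := abs_exp_sub_exp_le (Real.log a * p) (Real.log b * p)
    rw [← Real.rpow_def_of_pos ha0, ← Real.rpow_def_of_pos hb, ← sub_mul, abs_mul,
      abs_of_nonneg hlog0] at h
    have hpa : |p| ≤ 1 := by rw [abs_le]; constructor <;> linarith
    calc _ ≤ _ := h
      _ ≤ 2 / κ * (a - b) ^ (κ / 2) * b ^ (-(κ / 2)) * 1 * b ^ (κ - 1 / 2) := by
        refine mul_le_mul (mul_le_mul hlogab hpa (abs_nonneg _) ?_) (max_le hap (hbq p hp)) ?_ ?_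
        · exact hlog0.trans hlogab
        · positivity
        · have := hlog0.trans hlogab; positivity
      _ = _ := by rw [mul_one, mul_assoc, hsplit]
  have h2 : |b ^ p - b ^ q| ≤ 2 / κ * |p - q| * b ^ ((κ - 1) / 2) := by
    have h := abs_exp_sub_exp_le (Real.log b * p) (Real.log b * q)
    rw [← Real.rpow_def_of_pos hb, ← Real.rpow_def_of_pos hb, ← mul_sub, abs_mul,
      abs_of_nonpos hlogb0] at h
    calc _ ≤ _ := h
      _ ≤ 2 / κ * b ^ (-(κ / 2)) * |p - q| * b ^ (κ - 1 / 2) := by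
        gcongr
        exact max_le (hbq p hp) (hbq q hq)
      _ = 2 / κ * |p - q| * (b ^ (-(κ / 2)) * b ^ (κ - 1 / 2)) := by ring
      _ = _ := by rw [hsplit]
  calc |a ^ p - b ^ q| = |(a ^ p - b ^ p) + (b ^ p - b ^ q)| := by ring_nf
    _ ≤ _ := abs_add_le _ _
    _ ≤ _ := add_le_add h1 h2
    _ = _ := by ring

theorem posPow_of_pos {x : ℝ} (hx : 0 < x) (p : ℝ) : posPow x p = x ^ p := if_pos hx

theorem posPow_of_nonpos {x : ℝ} (hx : x ≤ 0) (p : ℝ) : posPow x p = 0 := if_neg hx.not_gt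

theorem posPow_sq (x p : ℝ) : posPow x p ^ 2 = posPow x (2 * p) := by
  rcases le_or_gt x 0 with h | h
  · simp [posPow_of_nonpos h]
  · rw [posPow_of_pos h, posPow_of_pos h, mul_comm, Real.rpow_mul h.le]
    norm_num

theorem posPow_le_posPow {x p q : ℝ} (hx : x ≤ 1) (hpq : q ≤ p) : posPow x p ≤ posPow x q := by
  rcases le_or_gt x 0 with h | h
  · simp [posPow_of_nonpos h]
  · rw [posPow_of_pos h, posPow_of_pos h]
    exact Real.rpow_le_rpow_of_exponent_ge h hx hpq

theorem measurable_posPow (t p : ℝ) : Measurable fun u => posPow (t - u) p := by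
  unfold posPow
  exact Measurable.ite (measurableSet_lt measurable_const (by fun_prop)) (by fun_prop)
    measurable_const

theorem setIntegral_posPow {s t e : ℝ} (hst : s ≤ t) (he : -1 < e) :
    IntegrableOn (fun u => posPow (t - u) e) (Set.Ici s) ∧
      ∫ u in Set.Ici s, posPow (t - u) e = (t - s) ^ (e + 1) / (e + 1) := by
  have h1 : IntervalIntegrable (fun u => (t - u) ^ e) volume s t := by
    have := (intervalIntegral.intervalIntegrable_rpow' (a := t - s) (b := 0) he).comp_sub_left t
    simpa using this
  have hInd : ∀ u ∈ Set.Ici s, posPow (t - u) e =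
      (Set.Ioc s t).indicator (fun u => posPow (t - u) e) u ∨ u = s := by
    intro u hu
    rcases eq_or_lt_of_le (Set.mem_Ici.1 hu) with h | h
    · exact Or.inr h.symm
    · left
      by_cases hut : u ≤ t
      · rw [Set.indicator_of_mem (show u ∈ Set.Ioc s t from ⟨h, hut⟩)]
      · rw [Set.indicator_of_notMem (fun hh => hut hh.2), posPow_of_nonpos (by linarith)]
  have hae : (fun u => posPow (t - u) e) =ᵐ[volume.restrict (Set.Ici s)]
      (Set.Ioc s t).indicator (fun u => posPow (t - u) e) := by
    rw [EventuallyEq, ae_restrict_iff' measurableSet_Ici]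
    have hs : ∀ᵐ u : ℝ, u ≠ s := by simp [ae_iff, measure_singleton]
    filter_upwards [hs] with u hu hu'
    exact (hInd u hu').resolve_right hu
  -- The endpoint `u = t` is discarded because for `e = 0` the real power there is `1`, whereas
  -- `posPow` is `0`.
  have hae2 : ∀ᵐ u : ℝ, u ∈ Set.Ioc s t → (t - u) ^ e = posPow (t - u) e := by
    have hs : ∀ᵐ u : ℝ, u ≠ t := by simp [ae_iff, measure_singleton]
    filter_upwards [hs] with u hu hu'
    rw [posPow_of_pos (sub_pos.2 (lt_of_le_of_ne hu'.2 hu))]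
  have h2 : IntegrableOn (fun u => posPow (t - u) e) (Set.Ioc s t) :=
    ((intervalIntegrable_iff_integrableOn_Ioc_of_le hst).1 h1).congr_fun_ae
      ((ae_restrict_iff' measurableSet_Ioc).2 hae2)
  have hsub : Set.Ioc s t ⊆ Set.Ici s := fun u hu => hu.1.le
  constructor
  · refine IntegrableOn.congr_fun_ae ?_ hae.symm
    rw [IntegrableOn, integrable_indicator_iff measurableSet_Ioc, IntegrableOn,
      Measure.restrict_restrict measurableSet_Ioc, Set.inter_eq_left.2 hsub]
    exact h2
  · rw [integral_congr_ae hae, integral_indicator measurableSet_Ioc,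
      Measure.restrict_restrict measurableSet_Ioc, Set.inter_eq_left.2 hsub,
      ← setIntegral_congr_ae measurableSet_Ioc hae2,
      ← intervalIntegral.integral_of_le hst]
    rw [intervalIntegral.integral_comp_sub_left (fun x => x ^ e) t, sub_self,
      integral_rpow (Or.inl he), Real.zero_rpow (by linarith), sub_zero]

theorem memLp_posPow {κ p t : ℝ} (hκ : 0 < κ) (hp : κ - 1 / 2 ≤ p) (ht : 0 ≤ t) (ht1 : t ≤ 1) :
    MemLp (fun u => posPow (t - u) p) 2 (volume.restrict (Set.Ici 0)) ∧
      ∫ u in Set.Ici 0, posPow (t - u) p ^ 2 ≤ 1 / (2 * κ) := by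
  have h1 := setIntegral_posPow ht (e := 2 * p) (by linarith)
  have h2 := setIntegral_posPow ht (e := 2 * κ - 1) (by linarith)
  constructor
  · rw [memLp_two_iff_integrable_sq (measurable_posPow t p).aestronglyMeasurable]
    simp_rw [posPow_sq]
    exact h1.1
  · simp_rw [posPow_sq]
    calc _ ≤ ∫ u in Set.Ici 0, posPow (t - u) (2 * κ - 1) := by
          refine setIntegral_mono_on h1.1 h2.1 measurableSet_Ici fun u hu => ?_
          exact posPow_le_posPow (by linarith [Set.mem_Ici.1 hu]) (by linarith)
      _ ≤ 1 / (2 * κ) := by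
          rw [h2.2, sub_zero, sub_add_cancel]
          gcongr
          exact Real.rpow_le_one ht ht1 (by linarith)

/-- For `s ≤ t`, only the kernel of `t` survives beyond `s`, and its squared norm there is at most
`(t - s) ^ (2κ) / (2κ)`. Below `s`, `abs_rpow_sub_rpow_le` leaves the integrable singularity `(s -
u) ^ (κ - 1)`. -/
theorem integral_posPow_sub_sq_le {κ p q s t : ℝ} (hκ : 0 < κ) (hκ1 : κ ≤ 1 / 2)
    (hp : κ - 1 / 2 ≤ p) (hp' : p ≤ 1 / 2) (hq : κ - 1 / 2 ≤ q) (hq' : q ≤ 1 / 2)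
    (hs : 0 ≤ s) (hs1 : s ≤ 1) (ht : 0 ≤ t) (ht1 : t ≤ 1) :
    ∫ u in Set.Ici 0, (posPow (t - u) p - posPow (s - u) q) ^ 2 ≤
      (1 / (2 * κ) + 8 / κ ^ 3) * (|t - s| ^ κ + (p - q) ^ 2) := by
  wlog hst : s ≤ t generalizing s t p q
  · have := this hq hq' hp hp' ht ht1 hs hs1 (le_of_not_ge hst)
    rw [abs_sub_comm, ← neg_sq (p - q), neg_sub]
    refine le_of_eq_of_le (integral_congr_ae (ae_of_all _ fun u => ?_)) this
    simp only
    ring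
  set D := 2 / κ * ((t - s) ^ (κ / 2) + |p - q|) with hD
  have hD0 : 0 ≤ D := by
    have : 0 ≤ t - s := by linarith
    positivity
  have i1 := setIntegral_posPow hst (e := 2 * κ - 1) (by linarith)
  have i2 := setIntegral_posPow hs (e := κ - 1) (by linarith)
  have hsub : Set.Ici s ⊆ Set.Ici 0 := Set.Ici_subset_Ici.2 hs
  have j1 : IntegrableOn ((Set.Ici s).indicator fun u => posPow (t - u) (2 * κ - 1))
      (Set.Ici 0) := by
    rw [IntegrableOn, integrable_indicator_iff measurableSet_Ici, IntegrableOn,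
      Measure.restrict_restrict measurableSet_Ici, Set.inter_eq_left.2 hsub]
    exact i1.1
  have e1 : ∫ u in Set.Ici 0, (Set.Ici s).indicator (fun u => posPow (t - u) (2 * κ - 1)) u =
      (t - s) ^ (2 * κ) / (2 * κ) := by
    rw [integral_indicator measurableSet_Ici,
      Measure.restrict_restrict measurableSet_Ici, Set.inter_eq_left.2 hsub, i1.2]
    ring_nf
  have hpt : ∀ u ∈ Set.Ici (0 : ℝ), (posPow (t - u) p - posPow (s - u) q) ^ 2 ≤
      (Set.Ici s).indicator (fun u => posPow (t - u) (2 * κ - 1)) u +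
        D ^ 2 * posPow (s - u) (κ - 1) := by
    intro u hu
    have hu0 : 0 ≤ u := hu
    by_cases hus : s ≤ u
    · rw [Set.indicator_of_mem (Set.mem_Ici.2 hus), posPow_of_nonpos (x := s - u) (by linarith),
        posPow_of_nonpos (x := s - u) (by linarith), sub_zero, mul_zero, add_zero, posPow_sq]
      exact posPow_le_posPow (by linarith) (by linarith)
    · have hus' : 0 < s - u := by linarith [not_le.1 hus]
      rw [Set.indicator_of_notMem (by simpa using hus), zero_add, posPow_of_pos hus',
        posPow_of_pos hus', posPow_of_pos (by linarith), ← sq_abs]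
      have h := abs_rpow_sub_rpow_le (a := t - u) (b := s - u) hκ hκ1 hp hp' hq hus'
        (by linarith) (by linarith)
      rw [show t - u - (s - u) = t - s by ring, ← hD] at h
      calc _ ≤ (D * (s - u) ^ ((κ - 1) / 2)) ^ 2 := by gcongr
        _ = D ^ 2 * (s - u) ^ (κ - 1) := by
          rw [mul_pow, ← Real.rpow_natCast ((s - u) ^ ((κ - 1) / 2)), ← Real.rpow_mul hus'.le]
          norm_num
  have hts : 0 ≤ t - s := by linarith
  calc _ ≤ ∫ u in Set.Ici 0, ((Set.Ici s).indicator (fun u => posPow (t - u) (2 * κ - 1)) u +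
        D ^ 2 * posPow (s - u) (κ - 1)) := by
        refine integral_mono_of_nonneg (ae_of_all _ fun u => sq_nonneg _) ?_ ?_
        · exact j1.add (i2.1.const_mul _)
        · exact (ae_restrict_iff' measurableSet_Ici).2 (ae_of_all _ hpt)
    _ = (t - s) ^ (2 * κ) / (2 * κ) + D ^ 2 * (s ^ κ / κ) := by
        rw [integral_add j1 (i2.1.const_mul _), e1, integral_const_mul, i2.2, sub_zero,
          sub_add_cancel]
    _ ≤ |t - s| ^ κ * (1 / (2 * κ)) + 8 / κ ^ 2 * (|t - s| ^ κ + (p - q) ^ 2) * (1 / κ) := by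
        rw [abs_of_nonneg hts, div_eq_mul_one_div]
        have a1 : (t - s) ^ (2 * κ) ≤ (t - s) ^ κ := by
          rcases hts.eq_or_lt with h | h
          · rw [← h, Real.zero_rpow (by positivity), Real.zero_rpow (by positivity)]
          · exact Real.rpow_le_rpow_of_exponent_ge h (by linarith) (by linarith)
        have a2 : s ^ κ ≤ 1 := Real.rpow_le_one hs hs1 hκ.le
        have a3 : D ^ 2 ≤ 8 / κ ^ 2 * ((t - s) ^ κ + (p - q) ^ 2) := by
          have : ((t - s) ^ (κ / 2)) ^ 2 = (t - s) ^ κ := by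
            rw [← Real.rpow_natCast, ← Real.rpow_mul hts]; norm_num
          rw [hD, mul_pow, ← this, ← sq_abs (p - q)]
          calc _ ≤ (2 / κ) ^ 2 * (2 * (((t - s) ^ (κ / 2)) ^ 2 + |p - q| ^ 2)) := by
                gcongr
                nlinarith [sq_nonneg ((t - s) ^ (κ / 2) - |p - q|)]
            _ = _ := by ring
        gcongr
    _ ≤ (1 / (2 * κ) + 8 / κ ^ 3) * (|t - s| ^ κ + (p - q) ^ 2) := by
        have : 0 ≤ 1 / (2 * κ) * (p - q) ^ 2 := by positivity
        have e : 8 / κ ^ 2 * (|t - s| ^ κ + (p - q) ^ 2) * (1 / κ) =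
          8 / κ ^ 3 * (|t - s| ^ κ + (p - q) ^ 2) := by field_simp
        rw [e]
        linarith

/-! ### Product kernels and their `L²` increments -/

/-- A telescoping bound, deliberately lossy: with `|f j| + |g j|` in all other slots, each summand
is a product of one-variable factors, so that Fubini applies. -/
theorem abs_prod_sub_prod_le {ι : Type*} [DecidableEq ι] (s : Finset ι) (f g : ι → ℝ) :
    |∏ i ∈ s, f i - ∏ i ∈ s, g i| ≤
      ∑ i ∈ s, ∏ j ∈ s, if j = i then |f j - g j| else |f j| + |g j| := by
  induction s using Finset.induction_on with
  | empty => simp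
  | insert a s ha ih =>
    rw [Finset.prod_insert ha, Finset.prod_insert ha, Finset.sum_insert ha]
    have h1 : |∏ i ∈ s, g i| ≤ ∏ j ∈ s, (|f j| + |g j|) := by
      rw [Finset.abs_prod]
      exact Finset.prod_le_prod (fun i _ => abs_nonneg _) fun i _ => by
        linarith [abs_nonneg (f i)]
    have e1 : (∏ j ∈ insert a s, if j = a then |f j - g j| else |f j| + |g j|) =
        |f a - g a| * ∏ j ∈ s, (|f j| + |g j|) := by
      rw [Finset.prod_insert ha, if_pos rfl]
      congr 1
      exact Finset.prod_congr rfl fun j hj => if_neg fun h : j = a => ha (h ▸ hj)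
    have e2 : (∑ i ∈ s, ∏ j ∈ insert a s, if j = i then |f j - g j| else |f j| + |g j|) =
        (|f a| + |g a|) * ∑ i ∈ s, ∏ j ∈ s, if j = i then |f j - g j| else |f j| + |g j| := by
      rw [Finset.mul_sum]
      refine Finset.sum_congr rfl fun i hi => ?_
      rw [Finset.prod_insert ha, if_neg fun h : a = i => ha (h ▸ hi)]
    rw [e1, e2]
    calc |f a * ∏ i ∈ s, f i - g a * ∏ i ∈ s, g i|
        = |(f a - g a) * ∏ i ∈ s, g i + f a * (∏ i ∈ s, f i - ∏ i ∈ s, g i)| := by ring_nf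
      _ ≤ |f a - g a| * |∏ i ∈ s, g i| + |f a| * |∏ i ∈ s, f i - ∏ i ∈ s, g i| := by
        rw [← abs_mul, ← abs_mul]
        exact abs_add_le _ _
      _ ≤ _ := by
        gcongr
        linarith [abs_nonneg (g a)]

theorem measurable_prod_eval {ι : Type*} [Fintype ι] {f : ι → ℝ → ℝ} (hf : ∀ i, Measurable (f i)) :
    Measurable fun u : ι → ℝ => ∏ i, f i (u i) :=
  Finset.measurable_prod _ fun i _ => (hf i).comp (measurable_pi_apply i)

theorem memLp_two_prod {ι : Type*} [Fintype ι] {ν : Measure ℝ} [SigmaFinite ν] {f : ι → ℝ → ℝ}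
    (hm : ∀ i, Measurable (f i)) (hf : ∀ i, MemLp (f i) 2 ν) :
    MemLp (fun u : ι → ℝ => ∏ i, f i (u i)) 2 (Measure.pi fun _ => ν) := by
  rw [memLp_two_iff_integrable_sq (measurable_prod_eval hm).aestronglyMeasurable]
  simp_rw [← Finset.prod_pow]
  exact Integrable.fintype_prod fun i => (hf i).integrable_sq

/-- The `L²` distance of two product functions is controlled by that of the factors. -/
theorem integral_prod_sub_prod_sq_le {ι : Type*} [Fintype ι] {ν : Measure ℝ} [SigmaFinite ν]
    {f g : ι → ℝ → ℝ} (hf : ∀ i, MemLp (f i) 2 ν) (hg : ∀ i, MemLp (g i) 2 ν) {B ε : ℝ}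
    (hB : 1 ≤ B)
    (hfB : ∀ i, ∫ x, f i x ^ 2 ∂ν ≤ B) (hgB : ∀ i, ∫ x, g i x ^ 2 ∂ν ≤ B)
    (hfg : ∀ i, ∫ x, (f i x - g i x) ^ 2 ∂ν ≤ ε) :
    ∫ u : ι → ℝ, (∏ i, f i (u i) - ∏ i, g i (u i)) ^ 2 ∂(Measure.pi fun _ => ν) ≤
      (Fintype.card ι : ℝ) ^ 2 * (4 * B) ^ Fintype.card ι * ε := by
  classical
  rcases isEmpty_or_nonempty ι with hι | ⟨⟨i₀⟩⟩
  · simp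
  have hε : 0 ≤ ε := (integral_nonneg fun x => sq_nonneg (f i₀ x - g i₀ x)).trans (hfg i₀)
  -- The squared factors of the `i`-th telescoping term. Cauchy–Schwarz over the terms costs a
  -- factor `card ι`, and the integral of each term then factorises.
  let G : ι → ι → ℝ → ℝ := fun i j x =>
    if j = i then (f j x - g j x) ^ 2 else (|f j x| + |g j x|) ^ 2
  have hGint : ∀ i j, Integrable (G i j) ν := by
    intro i j
    by_cases h : j = i
    · simp only [G, if_pos h]; exact ((hf j).sub (hg j)).integrable_sq
    · simp only [G, if_neg h]; exact ((hf j).abs.add (hg j).abs).integrable_sq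
  have hG0 : ∀ i j, 0 ≤ ∫ x, G i j x ∂ν := fun i j => integral_nonneg fun x => by
    simp only [G, Pi.zero_apply]; split_ifs <;> positivity
  have hGB : ∀ i j, j ≠ i → ∫ x, G i j x ∂ν ≤ 4 * B := by
    intro i j h
    simp only [G, if_neg h]
    calc _ ≤ ∫ x, (2 * f j x ^ 2 + 2 * g j x ^ 2) ∂ν := by
          refine integral_mono ((hf j).abs.add (hg j).abs).integrable_sq
            (((hf j).integrable_sq.const_mul 2).add ((hg j).integrable_sq.const_mul 2)) fun x => ?_
          simp only
          rw [← sq_abs (f j x), ← sq_abs (g j x)]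
          nlinarith [sq_nonneg (|f j x| - |g j x|)]
      _ ≤ 4 * B := by
          rw [integral_add ((hf j).integrable_sq.const_mul 2) ((hg j).integrable_sq.const_mul 2),
            integral_const_mul, integral_const_mul]
          linarith [hfB j, hgB j]
  have hterm : ∀ i, ∫ u : ι → ℝ, ∏ j, G i j (u j) ∂(Measure.pi fun _ => ν) ≤
      (4 * B) ^ Fintype.card ι * ε := by
    intro i
    rw [integral_fintype_prod_eq_prod, ← Finset.mul_prod_erase _ _ (Finset.mem_univ i), mul_comm]
    have h1 : ∫ x, G i i x ∂ν ≤ ε := by simpa [G] using hfg i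
    -- Only `card ι - 1` factors occur; `1 ≤ B` permits the larger exponent.
    have h2 : ∏ j ∈ Finset.univ.erase i, ∫ x, G i j x ∂ν ≤ (4 * B) ^ Fintype.card ι := by
      calc _ ≤ ∏ _j ∈ Finset.univ.erase i, 4 * B :=
            Finset.prod_le_prod (fun j _ => hG0 i j) fun j hj => hGB i j (Finset.ne_of_mem_erase hj)
        _ ≤ _ := by
            rw [Finset.prod_const]
            exact pow_le_pow_right₀ (by linarith)
              ((Finset.card_le_card (Finset.erase_subset _ _)).trans_eq Finset.card_univ)
    exact mul_le_mul h2 h1 (hG0 i i) (by positivity)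
  have hpint : ∀ i, Integrable (fun u : ι → ℝ => ∏ j, G i j (u j)) (Measure.pi fun _ => ν) :=
    fun i => Integrable.fintype_prod fun j => hGint i j
  calc _ ≤ ∫ u : ι → ℝ, (Fintype.card ι : ℝ) * ∑ i, ∏ j, G i j (u j) ∂(Measure.pi fun _ => ν) := by
        refine integral_mono_of_nonneg (ae_of_all _ fun u => sq_nonneg _)
          ((integrable_finsetSum _ fun i _ => hpint i).const_mul _) (ae_of_all _ fun u => ?_)
        simp only
        rw [← sq_abs]
        calc _ ≤ (∑ i, ∏ j, if j = i then |f j (u j) - g j (u j)| else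
                |f j (u j)| + |g j (u j)|) ^ 2 := by
              gcongr
              exact abs_prod_sub_prod_le _ (fun i => f i (u i)) fun i => g i (u i)
          _ ≤ _ := sq_sum_le_card_mul_sum_sq
          _ = _ := by
              rw [Finset.card_univ]
              congr 1
              refine Finset.sum_congr rfl fun i _ => ?_
              rw [← Finset.prod_pow]
              refine Finset.prod_congr rfl fun j _ => ?_
              simp only [G]
              split_ifs <;> simp
    _ = (Fintype.card ι : ℝ) * ∑ i, ∫ u : ι → ℝ, ∏ j, G i j (u j) ∂(Measure.pi fun _ => ν) := by
        rw [integral_const_mul, integral_finsetSum _ fun i _ => hpint i]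
    _ ≤ (Fintype.card ι : ℝ) * ∑ _i : ι, (4 * B) ^ Fintype.card ι * ε := by
        gcongr with i
        exact hterm i
    _ = _ := by
        rw [Finset.sum_const, Finset.card_univ, nsmul_eq_mul]
        ring

theorem restrict_Ici_pi (d : ℕ) : (volume : Measure (Fin d → ℝ)).restrict (Set.Ici 0) =
    Measure.pi fun _ => (volume : Measure ℝ).restrict (Set.Ici 0) := by
  rw [← Set.pi_univ_Ici, volume_pi, Measure.restrict_pi_pi]
  rfl

theorem rlKernel_eq_zero {d : ℕ} (H : (Fin d → ℝ) → Fin d → ℝ) {t u : Fin d → ℝ} (i : Fin d)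
    (h : t i ≤ u i) : rlKernel H t u = 0 :=
  Finset.prod_eq_zero (Finset.mem_univ i) (posPow_of_nonpos (sub_nonpos.2 h) _)

/-- The Hölder hypothesis on `H` is Euclidean, while the cube carries the sup distance. -/
theorem norm_toLp_le {d : ℕ} (x : Fin d → ℝ) : ‖WithLp.toLp 2 x‖ ≤ Real.sqrt d * ‖x‖ := by
  rw [EuclideanSpace.norm_eq]
  refine Real.sqrt_le_iff.2 ⟨by positivity, ?_⟩
  rw [mul_pow, Real.sq_sqrt (Nat.cast_nonneg d)]
  calc ∑ i, ‖x i‖ ^ 2 ≤ ∑ _i : Fin d, ‖x‖ ^ 2 := by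
        gcongr with i
        exact norm_le_pi_norm x i
    _ = _ := by simp

theorem abs_apply_le_norm_toLp {d : ℕ} (x : Fin d → ℝ) (i : Fin d) : |x i| ≤ ‖WithLp.toLp 2 x‖ :=
  PiLp.norm_apply_le (WithLp.toLp 2 x) i

section Kernel

variable {d : ℕ} {H : (Fin d → ℝ) → Fin d → ℝ} {α β : Fin d → ℝ}

/-- A single margin `κ` serves all coordinates and parameters. Capping it at `1/2` makes `κ - 1/2`
nonpositive, as the one-dimensional estimates require. -/
theorem exists_uniform_exponent (hd : 0 < d) (hα : ∀ i, 0 < α i) (hβ : ∀ i, β i < 1)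
    (hH : ∀ t : Fin d → ℝ, 0 ≤ t → ∀ i, α i ≤ H t i ∧ H t i ≤ β i) :
    ∃ κ : ℝ, 0 < κ ∧ κ ≤ 1 / 2 ∧ ∀ (t : Cube d) i,
      κ - 1 / 2 ≤ H t i - 1 / 2 ∧ H t i - 1 / 2 ≤ 1 / 2 := by
  have : Nonempty (Fin d) := ⟨⟨0, hd⟩⟩
  obtain ⟨i₀, hi₀⟩ := Finite.exists_min α
  refine ⟨min (α i₀) (1 / 2), lt_min (hα i₀) (by norm_num), min_le_right _ _, fun t i => ?_⟩
  have h := hH t t.2.1 i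
  have h1 := (min_le_left (α i₀) (1 / 2)).trans (hi₀ i)
  exact ⟨by linarith [h.1], by linarith [h.2, hβ i]⟩

theorem memLp_rlKernel (hd : 0 < d) (hα : ∀ i, 0 < α i) (hβ : ∀ i, β i < 1)
    (hH : ∀ t : Fin d → ℝ, 0 ≤ t → ∀ i, α i ≤ H t i ∧ H t i ≤ β i) (t : Cube d) :
    MemLp (rlKernel H t) 2 (volume.restrict (Set.Ici 0)) := by
  obtain ⟨κ, hκ, hκ1, hp⟩ := exists_uniform_exponent hd hα hβ hH
  rw [restrict_Ici_pi]
  exact memLp_two_prod (fun i => measurable_posPow (t.1 i) (H t i - 1 / 2)) fun i =>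
    (memLp_posPow hκ (hp t i).1 (t.nonneg i) (t.le_one i)).1

/-- Hölder continuity in `L²` of the Riemann–Liouville kernel with respect to its parameter. -/
theorem exists_rlKernel_increment_le (hd : 0 < d) (hα : ∀ i, 0 < α i) (hβ : ∀ i, β i < 1)
    (hH : ∀ t : Fin d → ℝ, 0 ≤ t → ∀ i, α i ≤ H t i ∧ H t i ≤ β i) {K γ : ℝ} (hγ : 0 < γ)
    (hH_holder : ∀ t s : Fin d → ℝ, 0 ≤ t → 0 ≤ s →
      ‖WithLp.toLp 2 (H t - H s)‖ ≤ K * ‖WithLp.toLp 2 (t - s)‖ ^ γ) :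
    ∃ C η : ℝ, 0 ≤ C ∧ 0 < η ∧ ∀ s t : Cube d,
      ∫ u in Set.Ici 0, (rlKernel H s u - rlKernel H t u) ^ 2 ≤ C * dist s t ^ η := by
  obtain ⟨κ, hκ, hκ1, hp⟩ := exists_uniform_exponent hd hα hβ hH
  set B : ℝ := 1 / (2 * κ) with hB
  have hB1 : 1 ≤ B := by rw [hB, le_div_iff₀ (by positivity)]; linarith
  set c : ℝ := 1 / (2 * κ) + 8 / κ ^ 3 with hc
  set D : ℝ := 1 + (|K| * (Real.sqrt d) ^ γ) ^ 2 with hD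
  refine ⟨(d : ℝ) ^ 2 * (4 * B) ^ d * (c * D), min κ (2 * γ), by positivity,
    lt_min hκ (by positivity), fun s t => ?_⟩
  have hd1 : dist s t ≤ 1 := by
    rw [Cube.dist_le_iff zero_le_one]
    intro i
    rw [abs_le]
    constructor <;> linarith [s.nonneg i, t.nonneg i, s.le_one i, t.le_one i]
  -- Distances in the cube are at most `1`, so the smaller exponent dominates: `κ` comes from moving
  -- the singularity and `2γ` from the squared variation of `H`.
  have hpow : ∀ e, min κ (2 * γ) ≤ e → dist s t ^ e ≤ dist s t ^ min κ (2 * γ) := by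
    intro e he
    have hpos : 0 < min κ (2 * γ) := lt_min hκ (by positivity)
    rcases (dist_nonneg (x := s) (y := t)).eq_or_lt with h | h
    · rw [← h, Real.zero_rpow (by linarith), Real.zero_rpow hpos.ne']
    · exact Real.rpow_le_rpow_of_exponent_ge h hd1 he
  have hdist : dist s t = ‖s.1 - t.1‖ := by rw [Subtype.dist_eq, dist_eq_norm]
  have hfac : ∀ i, ∫ u in Set.Ici 0, (posPow (s.1 i - u) (H s i - 1 / 2) -
      posPow (t.1 i - u) (H t i - 1 / 2)) ^ 2 ≤ c * D * dist s t ^ min κ (2 * γ) := by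
    intro i
    have h1 := integral_posPow_sub_sq_le hκ hκ1 (hp s i).1 (hp s i).2 (hp t i).1 (hp t i).2
      (t.nonneg i) (t.le_one i) (s.nonneg i) (s.le_one i)
    refine h1.trans ?_
    rw [mul_assoc]
    refine mul_le_mul_of_nonneg_left ?_ (by positivity)
    have h2 : |s.1 i - t.1 i| ^ κ ≤ dist s t ^ min κ (2 * γ) := by
      refine le_trans ?_ (hpow κ (min_le_left _ _))
      exact Real.rpow_le_rpow (abs_nonneg _)
        ((Cube.dist_le_iff dist_nonneg).1 le_rfl i) hκ.le
    have h3 : |H s i - H t i| ≤ |K| * (Real.sqrt d) ^ γ * dist s t ^ γ := by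
      calc |H s i - H t i| ≤ ‖WithLp.toLp 2 (H s - H t)‖ := abs_apply_le_norm_toLp (H s - H t) i
        _ ≤ K * ‖WithLp.toLp 2 (s.1 - t.1)‖ ^ γ := hH_holder s t s.2.1 t.2.1
        _ ≤ |K| * (Real.sqrt d * dist s t) ^ γ := by
          gcongr
          · exact le_abs_self K
          · rw [hdist]; exact norm_toLp_le _
        _ = _ := by rw [Real.mul_rpow (by positivity) dist_nonneg, mul_assoc]
    have h4 : (H s i - 1 / 2 - (H t i - 1 / 2)) ^ 2 ≤
        (|K| * (Real.sqrt d) ^ γ) ^ 2 * dist s t ^ min κ (2 * γ) := by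
      rw [sub_sub_sub_cancel_right, ← sq_abs]
      calc _ ≤ (|K| * (Real.sqrt d) ^ γ * dist s t ^ γ) ^ 2 := by gcongr
        _ = (|K| * (Real.sqrt d) ^ γ) ^ 2 * dist s t ^ (2 * γ) := by
          rw [mul_pow, ← Real.rpow_natCast (dist s t ^ γ), ← Real.rpow_mul dist_nonneg]
          norm_num
          left
          ring_nf
        _ ≤ _ := mul_le_mul_of_nonneg_left (hpow _ (min_le_right _ _)) (by positivity)
    rw [hD, add_mul, one_mul]
    exact add_le_add h2 h4
  have hmem := fun (t : Cube d) i =>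
    memLp_posPow hκ (hp t i).1 (t.nonneg i) (t.le_one i)
  have := integral_prod_sub_prod_sq_le (fun i => (hmem s i).1) (fun i => (hmem t i).1) hB1
    (fun i => (hmem s i).2) (fun i => (hmem t i).2) hfac
  rw [restrict_Ici_pi]
  rw [Fintype.card_fin] at this
  refine this.trans (le_of_eq ?_)
  ring

end Kernel

/-! ### The partition of the unit cube into cells -/

/-- The half-open unit cube `[0,1)ᵈ`. -/
def unitBox (d : ℕ) : Set (Fin d → ℝ) := Set.univ.pi fun _ => Set.Ico 0 1

/-- The cell `[(k - 1) / n, k / n)`. -/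
def scaledCell {d : ℕ} (n : ℕ) (k : Fin d → ℕ+) : Set (Fin d → ℝ) := {u | (n : ℝ) • u ∈ cell k}

/-- The indices of the cells of mesh `1 / n` contained in the unit cube. -/
def cellIndices (d n : ℕ) : Finset (Fin d → ℕ+) :=
  Fintype.piFinset fun _ => (Finset.range n).image Nat.succPNat

theorem mem_cellIndices {d n : ℕ} {k : Fin d → ℕ+} :
    k ∈ cellIndices d n ↔ ∀ i, (k i : ℕ) ≤ n := by
  simp only [cellIndices, Fintype.mem_piFinset, Finset.mem_image, Finset.mem_range]
  refine forall_congr' fun i => ⟨?_, fun h => ⟨(k i).natPred, ?_, PNat.succPNat_natPred _⟩⟩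
  · rintro ⟨m, hm, h⟩
    rw [← h, Nat.succPNat_coe]
    exact hm
  · have := (k i).natPred_add_one
    omega

theorem measurableSet_unitBox (d : ℕ) : MeasurableSet (unitBox d) :=
  MeasurableSet.univ_pi fun _ => measurableSet_Ico

theorem mem_unitBox {d : ℕ} {u : Fin d → ℝ} : u ∈ unitBox d ↔ ∀ i, 0 ≤ u i ∧ u i < 1 := by
  simp [unitBox, Set.mem_pi]

theorem unitBox_subset_Ici (d : ℕ) : unitBox d ⊆ Set.Ici 0 := fun _ hu i => (mem_unitBox.1 hu i).1

theorem volume_unitBox (d : ℕ) : volume (unitBox d) = 1 := by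
  rw [unitBox, volume_pi_pi]
  simp

instance isProbabilityMeasure_unitBox (d : ℕ) :
    IsProbabilityMeasure (volume.restrict (unitBox d)) :=
  ⟨by rw [Measure.restrict_apply_univ, volume_unitBox]⟩

section Cells

variable {d n : ℕ}

theorem scaledCell_eq_pi (hn : n ≠ 0) (k : Fin d → ℕ+) : scaledCell n k =
    Set.univ.pi fun i => Set.Ico ((((k i : ℕ) : ℝ) - 1) / n) (((k i : ℕ) : ℝ) / n) := by
  have hn' : (0 : ℝ) < n := by positivity
  ext u
  simp only [scaledCell, cell, Set.mem_ofPred_eq, Set.mem_pi, Set.mem_univ, true_implies,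
    Set.mem_Ico, Pi.smul_apply, smul_eq_mul, div_le_iff₀ hn', lt_div_iff₀ hn', mul_comm]

theorem measurableSet_scaledCell (hn : n ≠ 0) (k : Fin d → ℕ+) :
    MeasurableSet (scaledCell n k) := by
  rw [scaledCell_eq_pi hn]
  exact MeasurableSet.univ_pi fun _ => measurableSet_Ico

theorem volume_real_scaledCell (hn : n ≠ 0) (k : Fin d → ℕ+) :
    volume.real (scaledCell n k) = ((n : ℝ) ^ d)⁻¹ := by
  rw [scaledCell_eq_pi hn, measureReal_def, volume_pi_pi, ENNReal.toReal_prod]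
  simp_rw [Real.volume_Ico, ← sub_div, sub_sub_cancel]
  simp [ENNReal.toReal_ofReal]

theorem disjoint_scaledCell {k k' : Fin d → ℕ+} (h : k ≠ k') :
    Disjoint (scaledCell n k) (scaledCell n k') := by
  rw [Set.disjoint_left]
  intro u hu hu'
  refine h (funext fun i => PNat.eq ?_)
  have h1 := hu i
  have h2 := hu' i
  have h3 : ((k i : ℕ) : ℝ) < (k' i : ℕ) + 1 := by linarith [h1.1, h2.2]
  have h4 : ((k' i : ℕ) : ℝ) < (k i : ℕ) + 1 := by linarith [h2.1, h1.2]
  have h3' : (k i : ℕ) < (k' i : ℕ) + 1 := by exact_mod_cast h3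
  have h4' : (k' i : ℕ) < (k i : ℕ) + 1 := by exact_mod_cast h4
  omega

theorem iUnion_scaledCell (hn : n ≠ 0) : ⋃ k ∈ cellIndices d n, scaledCell n k = unitBox d := by
  have hn' : (0 : ℝ) < n := by positivity
  ext u
  simp only [Set.mem_iUnion, exists_prop, mem_unitBox]
  constructor
  · rintro ⟨k, hk, hu⟩ i
    rw [mem_cellIndices] at hk
    have h1 := hu i
    simp only [Pi.smul_apply, smul_eq_mul] at h1
    have hk1 : (1 : ℝ) ≤ (k i : ℕ) := by exact_mod_cast one_le (a := k i)
    have hkn : ((k i : ℕ) : ℝ) ≤ n := by exact_mod_cast hk i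
    constructor
    · by_contra h
      have := mul_neg_of_pos_of_neg hn' (not_le.1 h)
      linarith
    · by_contra h
      have := mul_le_mul_of_nonneg_left (not_lt.1 h) hn'.le
      linarith
  · intro hu
    refine ⟨fun i => Nat.succPNat ⌊(n : ℝ) * u i⌋₊, ?_, fun i => ?_⟩
    · rw [mem_cellIndices]
      intro i
      rw [Nat.succPNat_coe]
      refine Nat.succ_le_of_lt ((Nat.floor_lt (mul_nonneg hn'.le (hu i).1)).2 ?_)
      exact mul_lt_of_lt_one_right hn' (hu i).2
    · simp only [Nat.succPNat_coe, Nat.succ_eq_add_one, Pi.smul_apply, smul_eq_mul]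
      push_cast
      rw [add_sub_cancel_right]
      exact ⟨Nat.floor_le (mul_nonneg hn'.le (hu i).1), Nat.lt_floor_add_one _⟩

theorem scaledCell_subset (hn : n ≠ 0) {k : Fin d → ℕ+} (hk : k ∈ cellIndices d n) :
    scaledCell n k ⊆ unitBox d := by
  rw [← iUnion_scaledCell hn]
  exact Set.subset_biUnion_of_mem (u := fun k => scaledCell n k) hk

theorem integral_unitBox_eq_sum (hn : n ≠ 0) {F : (Fin d → ℝ) → ℝ}
    (hF : IntegrableOn F (unitBox d)) :
    ∫ u in unitBox d, F u = ∑ k ∈ cellIndices d n, ∫ u in scaledCell n k, F u := by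
  rw [← iUnion_scaledCell hn]
  exact integral_biUnion_finset _ (fun k _ => measurableSet_scaledCell hn k)
    (fun k _ k' _ h => disjoint_scaledCell h) fun k hk => hF.mono_set (scaledCell_subset hn hk)

theorem dist_le_of_mem_scaledCell (hn : n ≠ 0) {k : Fin d → ℕ+} {u v : Fin d → ℝ}
    (hu : u ∈ scaledCell n k) (hv : v ∈ scaledCell n k) : dist u v ≤ 1 / n := by
  have hn' : (0 : ℝ) < n := by positivity
  rw [dist_pi_le_iff (by positivity)]
  intro i
  have h1 := hu i
  have h2 := hv i
  simp only [Pi.smul_apply, smul_eq_mul] at h1 h2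
  rw [Real.dist_eq, le_div_iff₀ hn',
    show |u i - v i| * (n : ℝ) = |(u i - v i) * n| by rw [abs_mul, abs_of_pos hn'], abs_le]
  constructor <;> nlinarith [h1.1, h1.2, h2.1, h2.2]

end Cells

/-! ### Cell averages as orthogonal projections in `L²` -/

/-- The normalised cell average `n ^ (d / 2) ∫_{[(k - 1) / n, k / n)} f`. -/
noncomputable def cellCoeff {d : ℕ} (n : ℕ) (f : (Fin d → ℝ) → ℝ) (k : Fin d → ℕ+) : ℝ :=
  (n : ℝ) ^ ((d : ℝ) / 2) * ∫ u in scaledCell n k, f u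

/-- The conditional expectation of `f` with respect to the partition of the unit cube in cells. -/
noncomputable def cellAverage {d : ℕ} (n : ℕ) (f : (Fin d → ℝ) → ℝ) (u : Fin d → ℝ) : ℝ :=
  ∑ k ∈ cellIndices d n, (n : ℝ) ^ d * (∫ v in scaledCell n k, f v) *
    (scaledCell n k).indicator 1 u

section Average

variable {d n : ℕ} {f g : (Fin d → ℝ) → ℝ}

theorem cellCoeff_sq (n : ℕ) (f : (Fin d → ℝ) → ℝ) (k : Fin d → ℕ+) :
    cellCoeff n f k ^ 2 = (n : ℝ) ^ d * (∫ u in scaledCell n k, f u) ^ 2 := by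
  rw [cellCoeff, mul_pow, ← Real.rpow_natCast, ← Real.rpow_mul (Nat.cast_nonneg n)]
  norm_num

theorem cellAverage_of_mem {k : Fin d → ℕ+} (hk : k ∈ cellIndices d n) {u : Fin d → ℝ}
    (hu : u ∈ scaledCell n k) :
    cellAverage n f u = (n : ℝ) ^ d * ∫ v in scaledCell n k, f v := by
  rw [cellAverage, Finset.sum_eq_single_of_mem k hk, Set.indicator_of_mem hu, Pi.one_apply, mul_one]
  intro k' _ hk'
  rw [Set.indicator_of_notMem fun h => Set.disjoint_left.1 (disjoint_scaledCell hk') h hu, mul_zero]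

theorem cellAverage_of_notMem (hn : n ≠ 0) {u : Fin d → ℝ} (hu : u ∉ unitBox d) :
    cellAverage n f u = 0 :=
  Finset.sum_eq_zero fun k hk => by
    rw [Set.indicator_of_notMem fun h => hu (scaledCell_subset hn hk h), mul_zero]

theorem memLp_cellAverage (hn : n ≠ 0) :
    MemLp (cellAverage n f) 2 (volume.restrict (unitBox d)) := by
  refine memLp_finsetSum _ fun k _ => MemLp.const_mul ?_ _
  exact (memLp_const (1 : ℝ)).indicator (measurableSet_scaledCell hn k)

theorem integrableOn_scaledCell_of_memLp (hn : n ≠ 0)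
    (hf : MemLp f 2 (volume.restrict (unitBox d)))
    {k : Fin d → ℕ+} (hk : k ∈ cellIndices d n) : IntegrableOn f (scaledCell n k) :=
  have h : IntegrableOn f (unitBox d) := hf.integrable (by norm_num)
  h.mono_set (scaledCell_subset hn hk)

/-- Pythagoras on one cell: `cellAverage` equals the mean of `f` there, and the cell has volume `n ^
(-d)`, so the squared norm of that constant is exactly `cellCoeff n f k ^ 2`. -/
theorem integral_sub_cellAverage_sq_scaledCell (hn : n ≠ 0)
    (hf : MemLp f 2 (volume.restrict (unitBox d))) {k : Fin d → ℕ+} (hk : k ∈ cellIndices d n) :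
    ∫ u in scaledCell n k, (f u - cellAverage n f u) ^ 2 =
      (∫ u in scaledCell n k, f u ^ 2) - cellCoeff n f k ^ 2 := by
  have h1 : IntegrableOn f (scaledCell n k) := integrableOn_scaledCell_of_memLp hn hf hk
  have h2' : IntegrableOn (fun u => f u ^ 2) (unitBox d) := hf.integrable_sq
  have h2 : IntegrableOn (fun u => f u ^ 2) (scaledCell n k) :=
    h2'.mono_set (scaledCell_subset hn hk)
  set c := (n : ℝ) ^ d * ∫ v in scaledCell n k, f v with hc
  have hn0 : (n : ℝ) ^ d ≠ 0 := by positivity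
  have hfin : volume (scaledCell n k) ≠ ⊤ :=
    ((measure_mono (scaledCell_subset hn hk)).trans_lt (by rw [volume_unitBox]; simp)).ne
  calc _ = ∫ u in scaledCell n k, (f u ^ 2 - (2 * c) * f u + c ^ 2) := by
        refine setIntegral_congr_fun (measurableSet_scaledCell hn k) fun u hu => ?_
        simp only [cellAverage_of_mem hk hu, ← hc]
        ring
    _ = (∫ u in scaledCell n k, f u ^ 2) - (2 * c) * (∫ u in scaledCell n k, f u) +
          c ^ 2 * ((n : ℝ) ^ d)⁻¹ := by
        have h3 : IntegrableOn (fun u => f u ^ 2 - (2 * c) * f u) (scaledCell n k) :=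
          h2.sub (h1.const_mul _)
        have h4 : IntegrableOn (fun _ : Fin d → ℝ => c ^ 2) (scaledCell n k) :=
          integrableOn_const hfin
        rw [integral_add h3 h4,
          integral_sub h2 (h1.const_mul _), integral_const_mul, setIntegral_const,
          volume_real_scaledCell hn, smul_eq_mul]
        ring
    _ = _ := by
        rw [cellCoeff_sq, hc]
        field_simp
        ring

theorem integral_sub_cellAverage_sq (hn : n ≠ 0) (hf : MemLp f 2 (volume.restrict (unitBox d))) :
    ∫ u in unitBox d, (f u - cellAverage n f u) ^ 2 =
      (∫ u in unitBox d, f u ^ 2) - ∑ k ∈ cellIndices d n, cellCoeff n f k ^ 2 := by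
  have h : IntegrableOn (fun u => (f u - cellAverage n f u) ^ 2) (unitBox d) :=
    (hf.sub (memLp_cellAverage hn)).integrable_sq
  rw [integral_unitBox_eq_sum hn h,
    integral_unitBox_eq_sum hn hf.integrable_sq, ← Finset.sum_sub_distrib]
  exact Finset.sum_congr rfl fun k hk => integral_sub_cellAverage_sq_scaledCell hn hf hk

theorem sum_cellCoeff_sq_le (n : ℕ) (hd : 0 < d) (hf : MemLp f 2 (volume.restrict (unitBox d))) :
    ∑ k ∈ cellIndices d n, cellCoeff n f k ^ 2 ≤ ∫ u in unitBox d, f u ^ 2 := by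
  rcases eq_or_ne n 0 with rfl | hn
  · have : ∀ k : Fin d → ℕ+, cellCoeff 0 f k ^ 2 = 0 := fun k => by
      rw [cellCoeff_sq, Nat.cast_zero, zero_pow hd.ne', zero_mul]
    simp only [this, Finset.sum_const_zero]
    exact integral_nonneg fun u => sq_nonneg _
  have h1 := integral_sub_cellAverage_sq hn hf
  have h2 : 0 ≤ ∫ u in unitBox d, (f u - cellAverage n f u) ^ 2 :=
    integral_nonneg fun u => sq_nonneg _
  linarith

theorem cellCoeff_sub (hn : n ≠ 0) (hf : MemLp f 2 (volume.restrict (unitBox d)))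
    (hg : MemLp g 2 (volume.restrict (unitBox d))) {k : Fin d → ℕ+} (hk : k ∈ cellIndices d n) :
    cellCoeff n (fun u => f u - g u) k = cellCoeff n f k - cellCoeff n g k := by
  rw [cellCoeff, cellCoeff, cellCoeff, integral_sub (integrableOn_scaledCell_of_memLp hn hf hk)
    (integrableOn_scaledCell_of_memLp hn hg hk), mul_sub]

theorem cellAverage_sub (hn : n ≠ 0) (hf : MemLp f 2 (volume.restrict (unitBox d)))
    (hg : MemLp g 2 (volume.restrict (unitBox d))) (u : Fin d → ℝ) :
    cellAverage n (fun u => f u - g u) u = cellAverage n f u - cellAverage n g u := by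
  rw [cellAverage, cellAverage, cellAverage, ← Finset.sum_sub_distrib]
  refine Finset.sum_congr rfl fun k hk => ?_
  rw [integral_sub (integrableOn_scaledCell_of_memLp hn hf hk)
    (integrableOn_scaledCell_of_memLp hn hg hk)]
  ring

theorem abs_sub_cellAverage_le (hn : n ≠ 0) (hg : MemLp g 2 (volume.restrict (unitBox d)))
    {ε : ℝ} (hε : ∀ u v, dist u v ≤ 1 / n → |g u - g v| ≤ ε) {u : Fin d → ℝ}
    (hu : u ∈ unitBox d) : |g u - cellAverage n g u| ≤ ε := by
  rw [← iUnion_scaledCell hn, Set.mem_iUnion₂] at hu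
  obtain ⟨k, hk, huk⟩ := hu
  have hfin : volume (scaledCell n k) < ⊤ :=
    (measure_mono (scaledCell_subset hn hk)).trans_lt (by rw [volume_unitBox]; simp)
  have hn0 : (n : ℝ) ^ d ≠ 0 := by positivity
  have h1 := norm_setIntegral_le_of_norm_le_const hfin (f := fun v => g u - g v) (C := ε)
    fun v hv => hε u v (dist_le_of_mem_scaledCell hn huk hv)
  have h2 : IntegrableOn (fun _ : Fin d → ℝ => g u) (scaledCell n k) := integrableOn_const hfin.ne
  rw [volume_real_scaledCell hn, integral_sub h2
    (integrableOn_scaledCell_of_memLp hn hg hk), setIntegral_const, volume_real_scaledCell hn,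
    smul_eq_mul, Real.norm_eq_abs, ← div_eq_mul_inv, le_div_iff₀ (by positivity)] at h1
  rw [cellAverage_of_mem hk huk]
  refine le_of_eq_of_le ?_ h1
  rw [← abs_of_pos (by positivity : (0 : ℝ) < n ^ d), ← abs_mul,
    abs_of_pos (by positivity : (0 : ℝ) < n ^ d)]
  congr 1
  field_simp

theorem integral_add_sq_le {X : Type*} [MeasurableSpace X] {μ : Measure X} {f g : X → ℝ}
    (hf : MemLp f 2 μ) (hg : MemLp g 2 μ) :
    ∫ x, (f x + g x) ^ 2 ∂μ ≤ 2 * ∫ x, f x ^ 2 ∂μ + 2 * ∫ x, g x ^ 2 ∂μ := by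
  rw [← integral_const_mul, ← integral_const_mul, ← integral_add (hf.integrable_sq.const_mul 2)
    (hg.integrable_sq.const_mul 2)]
  refine integral_mono (hf.add hg).integrable_sq
    ((hf.integrable_sq.const_mul 2).add (hg.integrable_sq.const_mul 2)) fun x => ?_
  simp only
  nlinarith [sq_nonneg (f x - g x)]

theorem exists_continuous_integral_sub_sq_le (hf : MemLp f 2 (volume.restrict (unitBox d)))
    {ε : ℝ} (hε : 0 < ε) : ∃ g : (Fin d → ℝ) → ℝ, HasCompactSupport g ∧ Continuous g ∧
      MemLp g 2 (volume.restrict (unitBox d)) ∧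
      ∫ u in unitBox d, (f u - g u) ^ 2 ≤ ε := by
  have hf' : MemLp f (ENNReal.ofReal 2) (volume.restrict (unitBox d)) := by simpa using hf
  obtain ⟨g, h1, h2, h3, h4⟩ := hf'.exists_hasCompactSupport_integral_rpow_sub_le two_pos hε
  refine ⟨g, h1, h3, by simpa using h4, le_of_eq_of_le ?_ h2⟩
  simp

/-- Density argument: for a uniformly continuous `g` near `f` in `L²`, averaging over small cells
changes `g` uniformly little, and on `f - g` the projection residual does not exceed the norm. -/
theorem tendsto_integral_sub_cellAverage_sq (hf : MemLp f 2 (volume.restrict (unitBox d))) :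
    Tendsto (fun n => ∫ u in unitBox d, (f u - cellAverage n f u) ^ 2) atTop (𝓝 0) := by
  rw [Metric.tendsto_atTop]
  intro ε hε
  obtain ⟨g, hgs, hgc, hg, hfg⟩ := exists_continuous_integral_sub_sq_le hf
    (by positivity : 0 < ε / 8)
  have huc := hgs.uniformContinuous_of_continuous hgc
  -- The bound by `1` ensures `ε' ^ 2 ≤ ε / 8`.
  set ε' : ℝ := min 1 (ε / 8) with hε'
  have hε0 : 0 < ε' := lt_min one_pos (by positivity)
  obtain ⟨δ, hδ, hgδ⟩ := Metric.uniformContinuous_iff.1 huc ε' hε0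
  obtain ⟨N, hN⟩ := exists_nat_one_div_lt hδ
  refine ⟨N + 1, fun n hnN => ?_⟩
  have hn : n ≠ 0 := by omega
  have hbd : ∀ u v, dist u v ≤ 1 / (n : ℝ) → |g u - g v| ≤ ε' := fun u v huv => by
    refine (hgδ (huv.trans_lt (lt_of_le_of_lt ?_ hN))).le
    have : (N : ℝ) + 1 ≤ n := by exact_mod_cast hnN
    gcongr
  have hfgm : MemLp (fun u => f u - g u) 2 (volume.restrict (unitBox d)) := hf.sub hg
  have h1 : ∫ u in unitBox d, (f u - g u - cellAverage n (fun u => f u - g u) u) ^ 2 ≤ ε / 8 := by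
    rw [integral_sub_cellAverage_sq hn hfgm]
    have : 0 ≤ ∑ k ∈ cellIndices d n, cellCoeff n (fun u => f u - g u) k ^ 2 :=
      Finset.sum_nonneg fun k _ => sq_nonneg _
    linarith
  have h2 : ∫ u in unitBox d, (g u - cellAverage n g u) ^ 2 ≤ ε / 8 := by
    calc _ ≤ ∫ _u in unitBox d, ε' ^ 2 := by
          refine setIntegral_mono_on (hg.sub (memLp_cellAverage hn)).integrable_sq
            (integrable_const _) (measurableSet_unitBox d) fun u hu => ?_
          rw [← sq_abs]
          gcongr
          exact abs_sub_cellAverage_le hn hg hbd hu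
      _ = ε' ^ 2 := by simp
      _ ≤ ε / 8 := by
          have a1 : ε' ≤ 1 := min_le_left _ _
          have a2 : ε' ≤ ε / 8 := min_le_right _ _
          nlinarith
  have h3 := integral_add_sq_le (hfgm.sub (memLp_cellAverage (f := fun u => f u - g u) hn))
    (hg.sub (memLp_cellAverage (f := g) hn))
  have h4 : ∀ u, (f u - g u - cellAverage n (fun u => f u - g u) u) + (g u - cellAverage n g u) =
      f u - cellAverage n f u := fun u => by rw [cellAverage_sub hn hf hg]; ring
  simp only [Pi.sub_apply, h4] at h3
  rw [Real.dist_eq, sub_zero, abs_of_nonneg (integral_nonneg fun u => sq_nonneg _)]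
  linarith

theorem tendsto_sum_cellCoeff_sq (hf : MemLp f 2 (volume.restrict (unitBox d))) :
    Tendsto (fun n => ∑ k ∈ cellIndices d n, cellCoeff n f k ^ 2) atTop
      (𝓝 (∫ u in unitBox d, f u ^ 2)) := by
  have h1 := (tendsto_integral_sub_cellAverage_sq hf).const_sub (∫ u in unitBox d, f u ^ 2)
  rw [sub_zero] at h1
  refine h1.congr' ?_
  filter_upwards [eventually_ne_atTop 0] with n hn
  rw [integral_sub_cellAverage_sq hn hf]
  ring

/-- The asymptotic negligibility needed for the central limit theorem. After approximation by a
bounded `g`, the coefficients of `f - g` are individually controlled by Bessel's inequality, and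
those of `g` have squares of order `n ^ (-d)`. -/
theorem eventually_abs_cellCoeff_lt (hd : 0 < d) (hf : MemLp f 2 (volume.restrict (unitBox d)))
    {ε : ℝ} (hε : 0 < ε) : ∀ᶠ n in atTop, ∀ k ∈ cellIndices d n, |cellCoeff n f k| < ε := by
  obtain ⟨g, hgs, hgc, hg, hfg⟩ := exists_continuous_integral_sub_sq_le hf
    (by positivity : 0 < ε ^ 2 / 8)
  obtain ⟨G, hG⟩ := hgs.exists_bound_of_continuous hgc
  have hlim : Tendsto (fun n : ℕ => G ^ 2 * ((n : ℝ) ^ d)⁻¹) atTop (𝓝 (G ^ 2 * 0)) := by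
    refine Tendsto.const_mul _ (tendsto_inv_atTop_zero.comp ?_)
    exact (tendsto_pow_atTop hd.ne').comp tendsto_natCast_atTop_atTop
  rw [mul_zero] at hlim
  filter_upwards [eventually_ne_atTop 0,
    hlim.eventually_lt_const (by positivity : 0 < ε ^ 2 / 8)] with n hn hGn k hk
  have hfgm : MemLp (fun u => f u - g u) 2 (volume.restrict (unitBox d)) := hf.sub hg
  have h1 : cellCoeff n (fun u => f u - g u) k ^ 2 ≤ ε ^ 2 / 8 := by
    refine (Finset.single_le_sum (fun k _ => sq_nonneg _) hk).trans
      ((sum_cellCoeff_sq_le n hd hfgm).trans hfg)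
  have h2 : cellCoeff n g k ^ 2 ≤ G ^ 2 * ((n : ℝ) ^ d)⁻¹ := by
    have hfin : volume (scaledCell n k) < ⊤ :=
      (measure_mono (scaledCell_subset hn hk)).trans_lt (by rw [volume_unitBox]; simp)
    have h := norm_setIntegral_le_of_norm_le_const hfin (f := g) (C := G) fun v _ => hG v
    rw [volume_real_scaledCell hn, Real.norm_eq_abs] at h
    rw [cellCoeff_sq, ← sq_abs]
    calc _ ≤ (n : ℝ) ^ d * (G * ((n : ℝ) ^ d)⁻¹) ^ 2 := by gcongr
      _ = _ := by field_simp
  rw [cellCoeff_sub hn hf hg hk] at h1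
  refine abs_lt_of_sq_lt_sq ?_ hε.le
  nlinarith [sq_nonneg (cellCoeff n f k - 2 * cellCoeff n g k)]

end Average

/-! ### The approximating processes as finite linear forms -/

section Theta

variable {d : ℕ}

theorem theta_eq_sum {n : ℕ} (z : (Fin d → ℕ+) → ℝ) {u : Fin d → ℝ} (hu : u ∈ unitBox d) :
    theta z n u = (n : ℝ) ^ ((d : ℝ) / 2) *
      ∑ k ∈ cellIndices d n, z k * (scaledCell n k).indicator 1 u := by
  -- For `n = 0` the prefactor vanishes unless `d = 0`, and then the only index is the empty one.
  rcases eq_or_ne n 0 with rfl | hn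
  · rcases Nat.eq_zero_or_pos d with rfl | hd
    · have hk : ∀ k : Fin 0 → ℕ+, k ∈ cellIndices 0 0 := fun k => mem_cellIndices.2 fun i => i.elim0
      rw [theta, tsum_eq_sum (s := cellIndices 0 0) fun k hk' => absurd (hk k) hk']
      rfl
    · rw [theta, Nat.cast_zero, Real.zero_rpow (by positivity), zero_mul, zero_mul]
  · rw [theta, tsum_eq_sum (s := cellIndices d n)]
    · rfl
    · intro k hk
      rw [Set.indicator_of_notMem, mul_zero]
      intro h
      refine hk (mem_cellIndices.2 fun i => ?_)
      have h1 := (h i).1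
      have h2 := mul_lt_of_lt_one_right (by positivity : (0 : ℝ) < n) (mem_unitBox.1 hu i).2
      simp only [Pi.smul_apply, smul_eq_mul] at h1
      have h3 : ((k i : ℕ) : ℝ) < n + 1 := by linarith
      exact Nat.lt_succ_iff.1 (by exact_mod_cast h3)

/-- Some factor of the kernel vanishes as soon as a coordinate of `u` reaches `1`, so only the
finitely many cells inside the unit cube contribute. -/
theorem rlKernel_mul_theta (H : (Fin d → ℝ) → Fin d → ℝ) (z : (Fin d → ℕ+) → ℝ) {n : ℕ}
    (hn : n ≠ 0) (t : Cube d) {u : Fin d → ℝ} (hu : u ∈ Set.Ici 0) :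
    rlKernel H t u * theta z n u = ∑ k ∈ cellIndices d n,
      (n : ℝ) ^ ((d : ℝ) / 2) * z k * (scaledCell n k).indicator (rlKernel H t) u := by
  by_cases hb : u ∈ unitBox d
  · rw [theta_eq_sum z hb, Finset.mul_sum, Finset.mul_sum]
    refine Finset.sum_congr rfl fun k _ => ?_
    by_cases hk : u ∈ scaledCell n k
    · rw [Set.indicator_of_mem hk, Set.indicator_of_mem hk, Pi.one_apply]; ring
    · rw [Set.indicator_of_notMem hk, Set.indicator_of_notMem hk]; ring
  · rw [Finset.sum_eq_zero fun k hk => by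
      rw [Set.indicator_of_notMem fun h => hb (scaledCell_subset hn hk h), mul_zero]]
    simp only [mem_unitBox, not_forall, not_and, not_lt] at hb
    obtain ⟨i, hi⟩ := hb
    rw [rlKernel_eq_zero H i ((t.le_one i).trans (hi (hu i))), zero_mul]

theorem rlKernel_mul_theta_integrable {H : (Fin d → ℝ) → Fin d → ℝ} (hd : 0 < d) (t : Cube d)
    (hH : MemLp (rlKernel H t) 2 (volume.restrict (unitBox d))) (z : (Fin d → ℕ+) → ℝ) (n : ℕ) :
    IntegrableOn (fun u => rlKernel H t u * theta z n u) (Set.Ici 0) ∧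
      rlApprox H z n t = ∑ k ∈ cellIndices d n, cellCoeff n (rlKernel H t) k * z k := by
  rcases eq_or_ne n 0 with rfl | hn
  · have h0 : ∀ u, theta z 0 u = 0 := fun u => by
      rw [theta, Nat.cast_zero, Real.zero_rpow (by positivity), zero_mul]
    have h1 : ∀ k, cellCoeff 0 (rlKernel H t) k = 0 := fun k => by
      rw [cellCoeff, Nat.cast_zero, Real.zero_rpow (by positivity), zero_mul]
    simp [rlApprox, h0, h1]
  · have hsub : ∀ k ∈ cellIndices d n, scaledCell n k ⊆ Set.Ici 0 := fun k hk =>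
      (scaledCell_subset hn hk).trans (unitBox_subset_Ici d)
    have hint : ∀ k ∈ cellIndices d n,
        IntegrableOn (fun u => (n : ℝ) ^ ((d : ℝ) / 2) * z k *
          (scaledCell n k).indicator (rlKernel H t) u) (Set.Ici 0) := by
      intro k hk
      refine Integrable.const_mul ?_ _
      rw [integrable_indicator_iff (measurableSet_scaledCell hn k), IntegrableOn,
        Measure.restrict_restrict (measurableSet_scaledCell hn k),
        Set.inter_eq_left.2 (hsub k hk)]
      exact integrableOn_scaledCell_of_memLp hn hH hk
    have hI : MeasurableSet (Set.Ici (0 : Fin d → ℝ)) := measurableSet_Ici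
    constructor
    · refine IntegrableOn.congr_fun (integrable_finsetSum _ hint) (fun u hu => ?_) hI
      exact (rlKernel_mul_theta H z hn t hu).symm
    · rw [rlApprox, setIntegral_congr_fun hI fun u hu => rlKernel_mul_theta H z hn t hu,
        integral_finsetSum _ hint]
      refine Finset.sum_congr rfl fun k hk => ?_
      rw [integral_const_mul, integral_indicator (measurableSet_scaledCell hn k),
        Measure.restrict_restrict (measurableSet_scaledCell hn k),
        Set.inter_eq_left.2 (hsub k hk), cellCoeff]
      ring

end Theta

/-! ### Approximation by step functions -/

section StepFun

variable {d : ℕ}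

theorem stepFun_add (c c' : Orthant d →₀ ℝ) (u : Fin d → ℝ) :
    stepFun (c + c') u = stepFun c u + stepFun c' u :=
  Finsupp.sum_add_index' (fun _ => zero_mul _) fun _ _ _ => add_mul _ _ _

theorem stepFun_smul (a : ℝ) (c : Orthant d →₀ ℝ) (u : Fin d → ℝ) :
    stepFun (a • c) u = a * stepFun c u := by
  rw [stepFun, Finsupp.sum_smul_index fun _ => zero_mul _, stepFun, Finsupp.mul_sum]
  simp only [mul_assoc]

theorem stepFun_single (s : Orthant d) (u : Fin d → ℝ) :
    stepFun (Finsupp.single s 1) u = (Set.Icc (0 : Fin d → ℝ) s.1).indicator 1 u := by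
  rw [stepFun, Finsupp.sum_single_index (zero_mul _), one_mul]

theorem stepFun_sum {ι : Type*} (s : Finset ι) (c : ι → Orthant d →₀ ℝ) (u : Fin d → ℝ) :
    stepFun (∑ i ∈ s, c i) u = ∑ i ∈ s, stepFun (c i) u := by
  classical
  induction s using Finset.induction_on with
  | empty => simp [stepFun]
  | insert i s hi ih => rw [Finset.sum_insert hi, Finset.sum_insert hi, stepFun_add, ih]

theorem indicator_pi_eq_prod {ι : Type*} [Fintype ι] (S : ι → Set ℝ) (u : ι → ℝ) :
    (Set.univ.pi S).indicator (1 : (ι → ℝ) → ℝ) u = ∏ i, (S i).indicator 1 (u i) := by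
  by_cases h : u ∈ Set.univ.pi S
  · rw [Set.indicator_of_mem h]
    exact (Finset.prod_eq_one fun i _ => Set.indicator_of_mem (h i trivial) _).symm
  · rw [Set.indicator_of_notMem h]
    simp only [Set.mem_pi, Set.mem_univ, true_implies, not_forall] at h
    obtain ⟨i, hi⟩ := h
    exact (Finset.prod_eq_zero (Finset.mem_univ i) (Set.indicator_of_notMem hi _)).symm

/-- The indicator function of a half-open box is almost everywhere a step function. -/
theorem exists_stepFun_eq_indicator_box (a b : Fin d → ℝ) (ha : 0 ≤ a) (hab : a ≤ b) :
    ∃ c : Orthant d →₀ ℝ, ∀ᵐ u : Fin d → ℝ,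
      stepFun c u = (Set.univ.pi fun i => Set.Ico (a i) (b i)).indicator 1 u := by
  classical
  let corner : Finset (Fin d) → Orthant d := fun S =>
    ⟨fun i => if i ∈ S then b i else a i, fun i => by
      simp only [Pi.zero_apply]
      split_ifs
      · exact (ha i).trans (hab i)
      · exact ha i⟩
  -- Inclusion–exclusion over the corners of the box: expand `∏ i (1_{[0, b i]} - 1_{[0, a i]})`,
  -- with `S` the set of coordinates where the upper endpoint is chosen. The faces, where closed and
  -- half-open boxes differ, are null.
  refine ⟨∑ S ∈ Finset.univ.powerset, (∏ _i ∈ Finset.univ \ S, (-1 : ℝ)) •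
    Finsupp.single (corner S) 1, ?_⟩
  have hne : ∀ x : Fin d → ℝ, ∀ᵐ u : Fin d → ℝ, ∀ i, u i ≠ x i := fun x =>
    ae_all_iff.2 fun i => by
      rw [volume_pi]
      exact Measure.ae_eval_ne (μ := fun _ : Fin d => (volume : Measure ℝ)) i (x i)
  filter_upwards [hne a, hne b] with u hua hub
  rw [stepFun_sum, indicator_pi_eq_prod]
  have hfac : ∀ i, (Set.Ico (a i) (b i)).indicator (1 : ℝ → ℝ) (u i) =
      (Set.Icc 0 (b i)).indicator 1 (u i) + -(Set.Icc 0 (a i)).indicator 1 (u i) := by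
    intro i
    have h0 := ha i
    have h1 := hab i
    have h2 := hua i
    have h3 := hub i
    simp only [Pi.zero_apply] at h0
    simp only [Set.indicator_apply, Set.mem_Ico, Set.mem_Icc, Pi.one_apply]
    rcases lt_or_gt_of_ne h2 with h | h <;> rcases lt_or_gt_of_ne h3 with h' | h' <;>
      by_cases h'' : 0 ≤ u i <;> simp [h.le, h'.le, h.not_ge, h'.not_ge, h'', h'] <;> linarith
  simp_rw [hfac]
  rw [Finset.prod_add]
  refine Finset.sum_congr rfl fun S _ => ?_
  rw [stepFun_smul, stepFun_single, ← Set.pi_univ_Icc, indicator_pi_eq_prod,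
    ← Finset.prod_mul_prod_compl S, Finset.compl_eq_univ_sdiff]
  rw [Finset.prod_const, Finset.prod_neg]
  have e1 : ∏ i ∈ S, (Set.Icc ((0 : Fin d → ℝ) i) ((corner S).1 i)).indicator (1 : ℝ → ℝ) (u i) =
      ∏ i ∈ S, (Set.Icc 0 (b i)).indicator 1 (u i) :=
    Finset.prod_congr rfl fun i hi => by simp only [corner, if_pos hi, Pi.zero_apply]
  have e2 : ∏ i ∈ Finset.univ \ S,
      (Set.Icc ((0 : Fin d → ℝ) i) ((corner S).1 i)).indicator (1 : ℝ → ℝ) (u i) =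
      ∏ i ∈ Finset.univ \ S, (Set.Icc 0 (a i)).indicator 1 (u i) :=
    Finset.prod_congr rfl fun i hi => by
      simp only [corner, if_neg (Finset.mem_sdiff.1 hi).2, Pi.zero_apply]
  rw [e1, e2]
  ring

theorem exists_stepFun_eq_cellAverage {n : ℕ} (hn : n ≠ 0) (f : (Fin d → ℝ) → ℝ) :
    ∃ c : Orthant d →₀ ℝ, ∀ᵐ u : Fin d → ℝ, stepFun c u = cellAverage n f u := by
  have h : ∀ k : Fin d → ℕ+, ∃ c : Orthant d →₀ ℝ, ∀ᵐ u : Fin d → ℝ,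
      stepFun c u = (scaledCell n k).indicator 1 u := by
    intro k
    rw [scaledCell_eq_pi hn]
    refine exists_stepFun_eq_indicator_box _ _ (fun i => ?_) fun i => ?_
    · have : (1 : ℝ) ≤ (k i : ℕ) := by exact_mod_cast one_le (a := k i)
      exact div_nonneg (by linarith) (Nat.cast_nonneg n)
    · simp only
      gcongr
      linarith
  choose c hc using h
  refine ⟨∑ k ∈ cellIndices d n, ((n : ℝ) ^ d * ∫ v in scaledCell n k, f v) • c k, ?_⟩
  filter_upwards [ae_all_iff.2 hc] with u hu
  rw [stepFun_sum, cellAverage]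
  exact Finset.sum_congr rfl fun k _ => by rw [stepFun_smul, hu k]

/-- Square-integrable functions supported in the unit cube are limits of step functions. -/
theorem exists_stepFun_tendsto {f : (Fin d → ℝ) → ℝ} (hf : MemLp f 2 (volume.restrict (Set.Ici 0)))
    (hsupp : ∀ u ∈ Set.Ici 0, u ∉ unitBox d → f u = 0) :
    ∃ c : ℕ → Orthant d →₀ ℝ, Tendsto (fun m => eLpNorm (fun u => stepFun (c m) u - f u) 2
      (volume.restrict (Set.Ici 0))) atTop (𝓝 0) := by
  have hfb : MemLp f 2 (volume.restrict (unitBox d)) :=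
    hf.mono_measure (Measure.restrict_mono_set _ (unitBox_subset_Ici d))
  choose c hc using fun n : ℕ => exists_stepFun_eq_cellAverage n.succ_ne_zero f
  refine ⟨c, ?_⟩
  have h1 : ∀ n : ℕ, eLpNorm (fun u => stepFun (c n) u - f u) 2 (volume.restrict (Set.Ici 0)) =
      eLpNorm (fun u => f u - cellAverage (n + 1) f u) 2 (volume.restrict (unitBox d)) := by
    intro n
    rw [← eLpNorm_indicator_eq_eLpNorm_restrict (measurableSet_unitBox d)]
    rw [← eLpNorm_neg (f := fun u => stepFun (c n) u - f u),
      ← eLpNorm_indicator_eq_eLpNorm_restrict (f := -fun u => stepFun (c n) u - f u)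
      (measurableSet_Ici (a := (0 : Fin d → ℝ)))]
    refine eLpNorm_congr_ae ?_
    filter_upwards [hc n] with u hu
    by_cases hI : u ∈ Set.Ici 0
    · rw [Set.indicator_of_mem hI]
      simp only [Pi.neg_apply, hu, neg_sub]
      by_cases hb : u ∈ unitBox d
      · rw [Set.indicator_of_mem hb]
      · rw [Set.indicator_of_notMem hb, hsupp u hI hb, cellAverage_of_notMem n.succ_ne_zero hb,
          sub_zero]
    · rw [Set.indicator_of_notMem hI, Set.indicator_of_notMem fun h => hI (unitBox_subset_Ici d h)]
  simp_rw [h1]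
  have h2 : ∀ n : ℕ, eLpNorm (fun u => f u - cellAverage (n + 1) f u) 2
      (volume.restrict (unitBox d)) = ENNReal.ofReal
        ((∫ u in unitBox d, (f u - cellAverage (n + 1) f u) ^ 2) ^ (1 / 2 : ℝ)) := by
    intro n
    have h : MemLp (fun u => f u - cellAverage (n + 1) f u) 2 (volume.restrict (unitBox d)) :=
      hfb.sub (memLp_cellAverage n.succ_ne_zero)
    rw [h.eLpNorm_eq_integral_rpow_norm (by simp) (by simp)]
    simp
  simp_rw [h2]
  have h3 := ((tendsto_integral_sub_cellAverage_sq hfb).comp (tendsto_add_atTop_nat 1)).rpow_const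
    (p := (1 / 2 : ℝ)) (Or.inr (by norm_num))
  rw [Real.zero_rpow (by norm_num)] at h3
  simpa using ENNReal.tendsto_ofReal h3

end StepFun

/-! ### Gaussian moments and the Wiener integral -/

section SecondMoment

variable {X : Type*} [MeasurableSpace X] {μ : Measure X}

theorem eLpNorm_two_eq_ofReal {f : X → ℝ} (hf : MemLp f 2 μ) :
    eLpNorm f 2 μ = ENNReal.ofReal (Real.sqrt (∫ x, f x ^ 2 ∂μ)) := by
  rw [hf.eLpNorm_eq_integral_rpow_norm (by simp) (by simp), Real.sqrt_eq_rpow]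
  simp

theorem tendsto_integral_sq_of_tendsto_eLpNorm {f : ℕ → X → ℝ} {g : X → ℝ}
    (hf : ∀ n, MemLp (f n) 2 μ) (hg : MemLp g 2 μ)
    (h : Tendsto (fun n => eLpNorm (fun x => f n x - g x) 2 μ) atTop (𝓝 0)) :
    Tendsto (fun n => ∫ x, f n x ^ 2 ∂μ) atTop (𝓝 (∫ x, g x ^ 2 ∂μ)) := by
  have h1 := (Lp.tendsto_Lp_iff_tendsto_eLpNorm'' f hf g hg).2 h
  have h2 := (h1.norm).pow 2
  have e : ∀ {u : X → ℝ} (hu : MemLp u 2 μ), ‖hu.toLp u‖ ^ 2 = ∫ x, u x ^ 2 ∂μ := by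
    intro u hu
    rw [Lp.norm_toLp, eLpNorm_two_eq_ofReal hu, ENNReal.toReal_ofReal (Real.sqrt_nonneg _),
      Real.sq_sqrt (integral_nonneg fun x => sq_nonneg _)]
  simpa only [e] using h2

end SecondMoment

/-- Scaling by `√v` from the standard Gaussian. For the limit process this plays the part that
`exists_moment_sum_le` plays for the approximations. -/
theorem lintegral_abs_pow_gaussianReal (N : ℕ) {v : ℝ} (hv : 0 ≤ v) :
    ∫⁻ x, ENNReal.ofReal (|x| ^ (2 * N)) ∂(gaussianReal 0 v.toNNReal) =
      ENNReal.ofReal (v ^ N) * ∫⁻ x, ENNReal.ofReal (|x| ^ (2 * N)) ∂(gaussianReal 0 1) := by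
  have h1 : gaussianReal 0 v.toNNReal = (gaussianReal 0 1).map (Real.sqrt v * ·) := by
    rw [gaussianReal_map_const_mul]
    congr 1
    · simp
    · ext
      simp [Real.sq_sqrt hv, Real.coe_toNNReal v hv]
  rw [h1, lintegral_map (by fun_prop) (by fun_prop), ← lintegral_const_mul _ (by fun_prop)]
  refine lintegral_congr fun x => ?_
  rw [← ENNReal.ofReal_mul (by positivity), abs_mul, mul_pow, abs_of_nonneg (Real.sqrt_nonneg v),
    pow_mul (Real.sqrt v), Real.sq_sqrt hv]

theorem lintegral_abs_pow_gaussianReal_ne_top (N : ℕ) :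
    ∫⁻ x, ENNReal.ofReal (|x| ^ (2 * N)) ∂(gaussianReal 0 1) ≠ ⊤ := by
  have h := (memLp_id_gaussianReal' (μ := 0) (v := 1) ((2 * N : ℕ) : ENNReal)
    (ENNReal.natCast_ne_top _)).integrable_norm_pow'
  have := h.lintegral_lt_top
  simpa using this.ne

/-- Two boxes anchored at the origin intersect in such a box, whose volume is the covariance of the
sheet; this is the isometry on generators. -/
theorem integral_indicator_mul_indicator {d : ℕ} (s t : Orthant d) :
    IntegrableOn (fun u => (Set.Icc (0 : Fin d → ℝ) s.1).indicator (1 : (Fin d → ℝ) → ℝ) u *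
      (Set.Icc (0 : Fin d → ℝ) t.1).indicator 1 u) (Set.Ici 0) ∧
    ∫ u in Set.Ici 0, (Set.Icc (0 : Fin d → ℝ) s.1).indicator (1 : (Fin d → ℝ) → ℝ) u *
      (Set.Icc (0 : Fin d → ℝ) t.1).indicator 1 u = ∏ i, min (s.1 i) (t.1 i) := by
  have e : (fun u => (Set.Icc (0 : Fin d → ℝ) s.1).indicator (1 : (Fin d → ℝ) → ℝ) u *
      (Set.Icc (0 : Fin d → ℝ) t.1).indicator 1 u) =
      (Set.Icc (0 : Fin d → ℝ) (s.1 ⊓ t.1)).indicator 1 := by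
    have h : Set.Icc (0 : Fin d → ℝ) (s.1 ⊓ t.1) = Set.Icc 0 s.1 ∩ Set.Icc 0 t.1 := by
      rw [Set.Icc_inter_Icc, sup_idem]
    rw [h, Set.inter_indicator_one]
    rfl
  have hsub : Set.Icc (0 : Fin d → ℝ) (s.1 ⊓ t.1) ⊆ Set.Ici 0 := fun u hu => hu.1
  rw [e]
  constructor
  · refine ((integrable_indicator_iff measurableSet_Icc).2 ?_).integrableOn
    exact integrableOn_const isCompact_Icc.measure_lt_top.ne
  · rw [integral_indicator_one measurableSet_Icc, measureReal_restrict_apply measurableSet_Icc,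
      Set.inter_eq_left.2 hsub, measureReal_def, Real.volume_Icc_pi_toReal]
    · simp
    · exact le_inf s.2 t.2

theorem stepIntegral_add {d : ℕ} {Ω : Type*} {W : Orthant d → Ω → ℝ}
    (c c' : Orthant d →₀ ℝ) (ω : Ω) :
    stepIntegral W (c + c') ω = stepIntegral W c ω + stepIntegral W c' ω :=
  Finsupp.sum_add_index' (fun _ => zero_mul _) fun _ _ _ => add_mul _ _ _

theorem stepIntegral_smul {d : ℕ} {Ω : Type*} {W : Orthant d → Ω → ℝ}
    (a : ℝ) (c : Orthant d →₀ ℝ) (ω : Ω) :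
    stepIntegral W (a • c) ω = a * stepIntegral W c ω := by
  rw [stepIntegral, Finsupp.sum_smul_index fun _ => zero_mul _, stepIntegral, Finsupp.mul_sum]
  simp only [mul_assoc]

section Wiener

variable {d : ℕ} {Ω : Type*} [MeasurableSpace Ω] {P : Measure Ω} {W : Orthant d → Ω → ℝ}

theorem memLp_stepFun (c : Orthant d →₀ ℝ) :
    MemLp (stepFun c) 2 (volume.restrict (Set.Ici 0)) := by
  refine memLp_finsetSum _ fun s _ => MemLp.const_mul ?_ _
  rw [memLp_two_iff_integrable_sq (measurable_one.indicator measurableSet_Icc).aestronglyMeasurable]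
  simp only [sq]
  exact (integral_indicator_mul_indicator s s).1

theorem IsWienerSheet.memLp (hW : IsWienerSheet W P) (t : Orthant d) : MemLp (W t) 2 P :=
  (hW.gaussian.hasGaussianLaw_eval t).memLp_two

theorem IsWienerSheet.memLp_stepIntegral (hW : IsWienerSheet W P) (c : Orthant d →₀ ℝ) :
    MemLp (stepIntegral W c) 2 P :=
  memLp_finsetSum _ fun s _ => (hW.memLp s).const_mul _

theorem IsWienerSheet.integral_stepIntegral (hW : IsWienerSheet W P) (c : Orthant d →₀ ℝ) :
    ∫ ω, stepIntegral W c ω ∂P = 0 := by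
  have := hW.gaussian.isProbabilityMeasure
  simp only [stepIntegral, Finsupp.sum]
  rw [integral_finsetSum _ fun s _ => ((hW.memLp s).integrable (by norm_num)).const_mul _]
  refine Finset.sum_eq_zero fun s _ => ?_
  rw [integral_const_mul, hW.centered, mul_zero]

/-- The Itô isometry for step functions. -/
theorem IsWienerSheet.integral_stepIntegral_sq (hW : IsWienerSheet W P) (c : Orthant d →₀ ℝ) :
    ∫ ω, stepIntegral W c ω ^ 2 ∂P = ∫ u in Set.Ici 0, stepFun c u ^ 2 := by
  have := hW.gaussian.isProbabilityMeasure
  have h1 : ∀ s t : Orthant d, ∫ ω, W s ω * W t ω ∂P = ∏ i, min (s.1 i) (t.1 i) := by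
    intro s t
    have h := covariance_eq_sub (hW.memLp s) (hW.memLp t)
    rw [hW.covariance_eq, hW.centered, zero_mul, sub_zero] at h
    exact h.symm
  have hi : ∀ s t : Orthant d, Integrable (fun ω => W s ω * W t ω) P := fun s t =>
    (hW.memLp s).integrable_mul (hW.memLp t)
  simp only [stepIntegral, stepFun, Finsupp.sum, sq, Finset.sum_mul_sum]
  rw [integral_finsetSum _ fun s _ => integrable_finsetSum _ fun t _ => by
      simpa only [mul_mul_mul_comm] using (hi s t).const_mul (c s * c t),
    integral_finsetSum _ fun s _ => integrable_finsetSum _ fun t _ => by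
      simpa only [mul_mul_mul_comm] using
        (integral_indicator_mul_indicator s t).1.const_mul (c s * c t)]
  refine Finset.sum_congr rfl fun s _ => ?_
  rw [integral_finsetSum _ fun t _ => by
      simpa only [mul_mul_mul_comm] using (hi s t).const_mul (c s * c t),
    integral_finsetSum _ fun t _ => by
      simpa only [mul_mul_mul_comm] using
        (integral_indicator_mul_indicator s t).1.const_mul (c s * c t)]
  refine Finset.sum_congr rfl fun t _ => ?_
  have e : ∀ x y : ℝ, c s * x * (c t * y) = c s * c t * (x * y) := fun x y => by ring
  simp only [e]
  rw [integral_const_mul, integral_const_mul, h1, (integral_indicator_mul_indicator s t).2]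

theorem IsWienerSheet.map_stepIntegral (hW : IsWienerSheet W P) (c : Orthant d →₀ ℝ) :
    P.map (stepIntegral W c) = gaussianReal 0 (∫ u in Set.Ici 0, stepFun c u ^ 2).toNNReal := by
  have := hW.gaussian.isProbabilityMeasure
  have h : HasGaussianLaw (stepIntegral W c) P :=
    (hW.gaussian.smul c).hasGaussianLaw_fun_sum (I := c.support)
  rw [h.map_eq_gaussianReal, hW.integral_stepIntegral,
    variance_of_integral_eq_zero (hW.memLp_stepIntegral c).aestronglyMeasurable.aemeasurable
      (hW.integral_stepIntegral c), hW.integral_stepIntegral_sq]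

/-- A Wiener integral is a centred Gaussian variable, with variance given by the isometry. -/
theorem IsWienerIntegral.map_eq (hW : IsWienerSheet W P) {f : (Fin d → ℝ) → ℝ} {Y : Ω → ℝ}
    (h : IsWienerIntegral W P f Y) :
    P.map Y = gaussianReal 0 (∫ u in Set.Ici 0, f u ^ 2).toNNReal := by
  have := hW.gaussian.isProbabilityMeasure
  obtain ⟨hf, hY, c, hc, hc'⟩ := h
  -- Convergence in `L²` implies convergence in law, and the variances of the Gaussian approximants
  -- converge, so characteristic functions identify the law of `Y`.
  have h1 : TendstoInMeasure P (fun m => stepIntegral W (c m)) atTop Y :=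
    tendstoInMeasure_of_tendsto_eLpNorm two_ne_zero
      (fun m => (hW.memLp_stepIntegral (c m)).aestronglyMeasurable) hY.aestronglyMeasurable hc'
  have h2 := h1.tendstoInDistribution fun m =>
    (hW.memLp_stepIntegral (c m)).aestronglyMeasurable.aemeasurable
  have : IsProbabilityMeasure (P.map Y) :=
    Measure.isProbabilityMeasure_map hY.aestronglyMeasurable.aemeasurable
  refine Measure.ext_of_charFun ?_
  ext ξ
  have h3 := ProbabilityMeasure.tendsto_iff_tendsto_charFun.1 h2.tendsto ξ
  simp only [ProbabilityMeasure.coe_mk, hW.map_stepIntegral] at h3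
  refine tendsto_nhds_unique h3 ?_
  have h4 := tendsto_integral_sq_of_tendsto_eLpNorm (fun m => memLp_stepFun (c m)) hf hc
  simp only [charFun_gaussianReal]
  have hnn : ∀ g : (Fin d → ℝ) → ℝ, 0 ≤ ∫ u in Set.Ici 0, g u ^ 2 := fun g =>
    integral_nonneg fun u => sq_nonneg _
  have h5 : ∀ g : (Fin d → ℝ) → ℝ, (((∫ u in Set.Ici 0, g u ^ 2).toNNReal : ℝ) : ℂ) =
      ((∫ u in Set.Ici 0, g u ^ 2 : ℝ) : ℂ) := fun g => by rw [Real.coe_toNNReal _ (hnn g)]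
  simp only [h5]
  exact (Continuous.tendsto (by fun_prop : Continuous fun x : ℝ =>
    Complex.exp (ξ * (0 : ℝ) * Complex.I - (x : ℂ) * ξ ^ 2 / 2)) _).comp h4

theorem IsWienerIntegral.add (hW : IsWienerSheet W P) {f g : (Fin d → ℝ) → ℝ} {X Y : Ω → ℝ}
    (hX : IsWienerIntegral W P f X) (hY : IsWienerIntegral W P g Y) :
    IsWienerIntegral W P (fun u => f u + g u) fun ω => X ω + Y ω := by
  obtain ⟨hf, hX, c, hc, hcX⟩ := hX
  obtain ⟨hg, hY, c', hc', hcY⟩ := hY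
  refine ⟨hf.add hg, hX.add hY, fun m => c m + c' m, ?_, ?_⟩
  · refine tendsto_of_tendsto_of_tendsto_of_le_of_le tendsto_const_nhds
      (by simpa using hc.add hc') (fun _ => zero_le) fun m => ?_
    refine le_of_eq_of_le (congrArg (fun F => eLpNorm F 2 _) (funext fun u => ?_))
      (eLpNorm_add_le ((memLp_stepFun (c m)).sub hf).aestronglyMeasurable
        ((memLp_stepFun (c' m)).sub hg).aestronglyMeasurable one_le_two)
    rw [stepFun_add]
    simp only [Pi.add_apply]
    ring
  · refine tendsto_of_tendsto_of_tendsto_of_le_of_le tendsto_const_nhds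
      (by simpa using hcX.add hcY) (fun _ => zero_le) fun m => ?_
    refine le_of_eq_of_le (congrArg (fun F => eLpNorm F 2 _) (funext fun u => ?_))
      (eLpNorm_add_le ((hW.memLp_stepIntegral (c m)).sub hX).aestronglyMeasurable
        ((hW.memLp_stepIntegral (c' m)).sub hY).aestronglyMeasurable one_le_two)
    rw [stepIntegral_add]
    simp only [Pi.add_apply]
    ring

theorem IsWienerIntegral.const_mul {f : (Fin d → ℝ) → ℝ} {X : Ω → ℝ} (a : ℝ)
    (hX : IsWienerIntegral W P f X) :
    IsWienerIntegral W P (fun u => a * f u) fun ω => a * X ω := by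
  obtain ⟨hf, hX, c, hc, hcX⟩ := hX
  refine ⟨hf.const_mul a, hX.const_mul a, fun m => a • c m, ?_, ?_⟩
  · have h : ∀ m, (fun u => stepFun (a • c m) u - a * f u) = a • fun u => stepFun (c m) u - f u :=
      fun m => funext fun u => by rw [stepFun_smul, Pi.smul_apply, smul_eq_mul, mul_sub]
    simp_rw [h, eLpNorm_const_smul]
    simpa using ENNReal.Tendsto.const_mul hc (Or.inr (by simp))
  · have h : ∀ m, (fun ω => stepIntegral W (a • c m) ω - a * X ω) =
        a • fun ω => stepIntegral W (c m) ω - X ω :=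
      fun m => funext fun u => by rw [stepIntegral_smul, Pi.smul_apply, smul_eq_mul, mul_sub]
    simp_rw [h, eLpNorm_const_smul]
    simpa using ENNReal.Tendsto.const_mul hcX (Or.inr (by simp))

theorem IsWienerIntegral.sub (hW : IsWienerSheet W P) {f g : (Fin d → ℝ) → ℝ} {X Y : Ω → ℝ}
    (hX : IsWienerIntegral W P f X) (hY : IsWienerIntegral W P g Y) :
    IsWienerIntegral W P (fun u => f u - g u) fun ω => X ω - Y ω := by
  have := hX.add hW (hY.const_mul (-1))
  simpa only [neg_one_mul, ← sub_eq_add_neg] using this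

/-- Through linearity, finite-dimensional laws of the sheet reduce to the law of one integral; joint
Gaussianity needs no separate argument. -/
theorem IsWienerIntegral.sum (hW : IsWienerSheet W P) {ι : Type*} (s : Finset ι)
    {f : ι → (Fin d → ℝ) → ℝ} {X : ι → Ω → ℝ} (h : ∀ i, IsWienerIntegral W P (f i) (X i)) :
    IsWienerIntegral W P (fun u => ∑ i ∈ s, f i u) fun ω => ∑ i ∈ s, X i ω := by
  classical
  induction s using Finset.induction_on with
  | empty =>
    simp only [Finset.sum_empty]
    exact ⟨MemLp.zero', MemLp.zero', fun _ => 0, by simp [stepFun], by simp [stepIntegral]⟩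
  | insert i s hi ih =>
    simp only [Finset.sum_insert hi]
    exact (h i).add hW ih

theorem IsWienerIntegral.congr_ae {f : (Fin d → ℝ) → ℝ} {X Y : Ω → ℝ}
    (hX : IsWienerIntegral W P f X) (hXY : ∀ᵐ ω ∂P, Y ω = X ω) : IsWienerIntegral W P f Y := by
  obtain ⟨hf, hX, c, hc, hcX⟩ := hX
  refine ⟨hf, hX.ae_eq (hXY.mono fun ω h => h.symm), c, hc, hcX.congr fun m => ?_⟩
  exact eLpNorm_congr_ae (hXY.mono fun ω h => by simp only [h])

/-- Existence of the Wiener integral of a limit of step functions. -/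
theorem exists_isWienerIntegral (hW : IsWienerSheet W P) {f : (Fin d → ℝ) → ℝ}
    (hf : MemLp f 2 (volume.restrict (Set.Ici 0))) {c : ℕ → Orthant d →₀ ℝ}
    (hc : Tendsto (fun m => eLpNorm (fun u => stepFun (c m) u - f u) 2
      (volume.restrict (Set.Ici 0))) atTop (𝓝 0)) :
    ∃ Y : Ω → ℝ, IsWienerIntegral W P f Y := by
  let F := fun m => (memLp_stepFun (c m)).toLp
  let I := fun m => (hW.memLp_stepIntegral (c m)).toLp
  have hF : CauchySeq F :=
    ((Lp.tendsto_Lp_iff_tendsto_eLpNorm'' _ (fun m => memLp_stepFun (c m)) f hf).2 hc).cauchySeq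
  -- The isometry, applied to the step function with coefficients `c m - c n`, transfers the Cauchy
  -- property from `L²` of the orthant to `L²(P)`.
  have hdist : ∀ m n, dist (I m) (I n) = dist (F m) (F n) := by
    intro m n
    have e1 : (fun u => stepFun (c m + (-1 : ℝ) • c n) u) = stepFun (c m) - stepFun (c n) := by
      ext u
      rw [stepFun_add, stepFun_smul, Pi.sub_apply]
      ring
    have e2 : (fun ω => stepIntegral W (c m + (-1 : ℝ) • c n) ω) =
        stepIntegral W (c m) - stepIntegral W (c n) := by
      ext ω
      rw [stepIntegral_add, stepIntegral_smul, Pi.sub_apply]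
      ring
    simp only [F, I, Lp.dist_def]
    rw [eLpNorm_congr_ae ((hW.memLp_stepIntegral (c m)).coeFn_toLp.sub
        (hW.memLp_stepIntegral (c n)).coeFn_toLp),
      eLpNorm_congr_ae ((memLp_stepFun (c m)).coeFn_toLp.sub (memLp_stepFun (c n)).coeFn_toLp),
      ← e1, ← e2, eLpNorm_two_eq_ofReal (hW.memLp_stepIntegral _),
      eLpNorm_two_eq_ofReal (memLp_stepFun _), hW.integral_stepIntegral_sq]
  have hI : CauchySeq I := by
    rw [Metric.cauchySeq_iff] at hF ⊢
    simpa only [hdist] using hF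
  obtain ⟨Y, hY⟩ := cauchySeq_tendsto_of_complete hI
  refine ⟨Y, hf, Lp.memLp Y, c, hc, ?_⟩
  rw [← Lp.toLp_coeFn Y (Lp.memLp Y)] at hY
  exact (Lp.tendsto_Lp_iff_tendsto_eLpNorm'' _ (fun m => hW.memLp_stepIntegral (c m)) Y
    (Lp.memLp Y)).1 hY

theorem IsWienerIntegral.lintegral_abs_pow (hW : IsWienerSheet W P) {f : (Fin d → ℝ) → ℝ}
    {Y : Ω → ℝ} (h : IsWienerIntegral W P f Y) (N : ℕ) :
    ∫⁻ ω, ENNReal.ofReal (|Y ω| ^ (2 * N)) ∂P = ENNReal.ofReal ((∫ u in Set.Ici 0, f u ^ 2) ^ N) *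
      ∫⁻ x, ENNReal.ofReal (|x| ^ (2 * N)) ∂(gaussianReal 0 1) := by
  rw [← lintegral_abs_pow_gaussianReal N (integral_nonneg fun u => sq_nonneg (f u)),
    ← h.map_eq hW, lintegral_map' (by fun_prop) h.2.1.aestronglyMeasurable.aemeasurable]

end Wiener

/-! ### Coefficients of the approximating processes -/

section Kernel

variable {d : ℕ}

theorem rlKernel_eq_zero_of_notMem_unitBox (H : (Fin d → ℝ) → Fin d → ℝ) (t : Cube d)
    {u : Fin d → ℝ} (hu : u ∈ Set.Ici 0) (hb : u ∉ unitBox d) : rlKernel H t u = 0 := by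
  simp only [mem_unitBox, not_forall, not_and, not_lt] at hb
  obtain ⟨i, hi⟩ := hb
  exact rlKernel_eq_zero H i ((t.le_one i).trans (hi (hu i)))

theorem setIntegral_unitBox_eq_of_eq_zero {g : (Fin d → ℝ) → ℝ}
    (h : ∀ u ∈ Set.Ici 0, u ∉ unitBox d → g u = 0) :
    ∫ u in unitBox d, g u = ∫ u in Set.Ici 0, g u :=
  (setIntegral_eq_of_subset_of_forall_sdiff_eq_zero measurableSet_Ici (unitBox_subset_Ici d)
    fun u hu => h u hu.1 hu.2).symm

theorem cellCoeff_zero (hd : 0 < d) (f : (Fin d → ℝ) → ℝ) (k : Fin d → ℕ+) :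
    cellCoeff 0 f k = 0 := by
  rw [cellCoeff, Nat.cast_zero, Real.zero_rpow (by positivity), zero_mul]

theorem cellCoeff_sum {n : ℕ} (hn : n ≠ 0) {ι : Type*} (s : Finset ι) (a : ι → ℝ)
    {f : ι → (Fin d → ℝ) → ℝ} (hf : ∀ i, MemLp (f i) 2 (volume.restrict (unitBox d)))
    {k : Fin d → ℕ+} (hk : k ∈ cellIndices d n) :
    cellCoeff n (fun u => ∑ i ∈ s, a i * f i u) k = ∑ i ∈ s, a i * cellCoeff n (f i) k := by
  simp only [cellCoeff]
  rw [integral_finsetSum _ fun i _ =>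
    (integrableOn_scaledCell_of_memLp hn (hf i) hk).const_mul (a i), Finset.mul_sum]
  refine Finset.sum_congr rfl fun i _ => ?_
  rw [integral_const_mul]
  ring

/-- The increments of the coefficients of the approximating processes are controlled by those of
the kernel. -/
theorem sum_cellCoeff_rlKernel_sub_sq_le (hd : 0 < d) {H : (Fin d → ℝ) → Fin d → ℝ}
    (hK : ∀ t : Cube d, MemLp (rlKernel H t) 2 (volume.restrict (Set.Ici 0))) (n : ℕ)
    (s t : Cube d) :
    ∑ k ∈ cellIndices d n, (cellCoeff n (rlKernel H s) k - cellCoeff n (rlKernel H t) k) ^ 2 ≤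
      ∫ u in Set.Ici 0, (rlKernel H s u - rlKernel H t u) ^ 2 := by
  rcases eq_or_ne n 0 with rfl | hn
  · simp only [cellCoeff_zero hd, sub_zero, ne_eq, OfNat.ofNat_ne_zero, not_false_eq_true,
      zero_pow, Finset.sum_const_zero]
    exact integral_nonneg fun u => sq_nonneg _
  · have hb : ∀ t : Cube d, MemLp (rlKernel H t) 2 (volume.restrict (unitBox d)) := fun t =>
      (hK t).mono_measure (Measure.restrict_mono_set _ (unitBox_subset_Ici d))
    rw [← setIntegral_unitBox_eq_of_eq_zero fun u hu hub => by
      rw [rlKernel_eq_zero_of_notMem_unitBox H s hu hub,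
        rlKernel_eq_zero_of_notMem_unitBox H t hu hub, sub_zero, zero_pow two_ne_zero]]
    refine le_of_eq_of_le (Finset.sum_congr rfl fun k hk => ?_)
      (sum_cellCoeff_sq_le n hd ((hb s).sub (hb t)))
    rw [← cellCoeff_sub hn (hb s) (hb t) hk]

/-- The squared increment of one coefficient is at most the whole sum of squares, which is Hölder.
Continuity of the paths of `X_n` follows from this. -/
theorem continuous_cellCoeff_rlKernel (hd : 0 < d) {H : (Fin d → ℝ) → Fin d → ℝ}
    (hK : ∀ t : Cube d, MemLp (rlKernel H t) 2 (volume.restrict (Set.Ici 0))) {C η : ℝ}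
    (hη : 0 < η) (hinc : ∀ s t : Cube d,
      ∫ u in Set.Ici 0, (rlKernel H s u - rlKernel H t u) ^ 2 ≤ C * dist s t ^ η)
    {n : ℕ} {k : Fin d → ℕ+} (hk : k ∈ cellIndices d n) :
    Continuous fun t : Cube d => cellCoeff n (rlKernel H t) k := by
  refine continuous_iff_continuousAt.2 fun t => tendsto_iff_dist_tendsto_zero.2 ?_
  have hlim : Tendsto (fun s : Cube d => Real.sqrt (C * dist s t ^ η)) (𝓝 t) (𝓝 0) := by
    have h : ContinuousAt (fun s : Cube d => Real.sqrt (C * dist s t ^ η)) t :=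
      (((continuous_id.dist continuous_const).rpow_const fun _ => Or.inr hη.le).const_mul
        C).sqrt.continuousAt
    have h' := h.tendsto
    rwa [dist_self, Real.zero_rpow hη.ne', mul_zero, Real.sqrt_zero] at h'
  refine squeeze_zero (fun _ => dist_nonneg) (fun s => ?_) hlim
  rw [Real.dist_eq]
  refine Real.abs_le_sqrt (le_trans ?_ ((sum_cellCoeff_rlKernel_sub_sq_le hd hK n s t).trans
    (hinc s t)))
  exact Finset.single_le_sum (f := fun k =>
    (cellCoeff n (rlKernel H s) k - cellCoeff n (rlKernel H t) k) ^ 2)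
    (fun k _ => sq_nonneg _) hk

end Kernel

/-! ### Tightness, continuous modification and the main theorem -/

/-- Choosing `N ≥ 2(d + 1) / η` gives `x ^ (ηN) ≤ 4 ^ (-(d + 1) m)`, the rate required by the
chaining criteria; moments of order `2N` are used. -/
theorem exists_pow_rate (d : ℕ) {C η : ℝ} (hC : 0 ≤ C) (hη : 0 < η) :
    ∃ N : ℕ, N ≠ 0 ∧ ∀ (m : ℕ) (x : ℝ), 0 ≤ x → x ≤ (1 / 2) ^ m →
      ENNReal.ofReal ((C * x ^ η) ^ N) ≤ ENNReal.ofReal (C ^ N) * ((4 ^ (d + 1)) ^ m)⁻¹ := by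
  obtain ⟨N, hN⟩ := exists_nat_ge ((2 * (d + 1) : ℕ) / η)
  rw [div_le_iff₀ hη] at hN
  have hN0 : N ≠ 0 := by
    rintro rfl
    rw [Nat.cast_zero, zero_mul] at hN
    exact absurd hN (not_le.2 (by positivity))
  refine ⟨N, hN0, fun m x hx hxm => ?_⟩
  have h1 : (x ^ η) ^ N ≤ ((4 ^ (d + 1)) ^ m)⁻¹ := by
    rw [← Real.rpow_natCast, ← Real.rpow_mul hx]
    calc x ^ (η * N) ≤ ((1 / 2 : ℝ) ^ m) ^ (η * N) := by gcongr
      _ ≤ ((1 / 2 : ℝ) ^ m) ^ ((2 * (d + 1) : ℕ) : ℝ) :=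
        Real.rpow_le_rpow_of_exponent_ge (by positivity) (pow_le_one₀ (by norm_num) (by norm_num))
          (by rwa [mul_comm η])
      _ = ((4 ^ (d + 1)) ^ m)⁻¹ := by
        rw [Real.rpow_natCast, pow_mul, ← pow_mul _ m 2, mul_comm m 2, pow_mul _ 2 m, ← pow_mul,
          mul_comm m, pow_mul, ← inv_pow, ← inv_pow]
        norm_num
  calc ENNReal.ofReal ((C * x ^ η) ^ N) ≤ ENNReal.ofReal (C ^ N * ((4 ^ (d + 1)) ^ m)⁻¹) := by
        rw [mul_pow]
        gcongr
    _ = _ := by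
      rw [ENNReal.ofReal_mul (by positivity), ENNReal.ofReal_inv_of_pos (by positivity),
        ENNReal.ofReal_pow (by positivity), ENNReal.ofReal_pow (by positivity)]
      simp

/-- Existence of a continuous modification of the Riemann–Liouville sheet. -/
theorem exists_isContinuousRLSheet {d : ℕ} {Ω : Type*} [MeasurableSpace Ω] {P : Measure Ω}
    {W : Orthant d → Ω → ℝ} (hW : IsWienerSheet W P) {H : (Fin d → ℝ) → Fin d → ℝ}
    (hK : ∀ t : Cube d, MemLp (rlKernel H t) 2 (volume.restrict (Set.Ici 0))) {C η : ℝ}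
    (hC : 0 ≤ C) (hη : 0 < η) (hinc : ∀ s t : Cube d,
      ∫ u in Set.Ici 0, (rlKernel H s u - rlKernel H t u) ^ 2 ≤ C * dist s t ^ η) :
    ∃ X : Ω → C(Cube d, ℝ), IsContinuousRLSheet H W P X := by
  have hex : ∀ t : Cube d, ∃ Y : Ω → ℝ, IsWienerIntegral W P (rlKernel H t) Y := fun t => by
    obtain ⟨c, hc⟩ := exists_stepFun_tendsto (hK t) fun u hu hb =>
      rlKernel_eq_zero_of_notMem_unitBox H t hu hb
    exact exists_isWienerIntegral hW (hK t) hc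
  choose V hV using hex
  obtain ⟨N, hN, hrate⟩ := exists_pow_rate d hC hη
  obtain ⟨X, hX⟩ := exists_continuous_modification (P := P) (X := V) (q := 2 * N) (by omega)
    (fun t => (hV t).2.1.aestronglyMeasurable.aemeasurable)
    (M := ENNReal.ofReal (C ^ N) * ∫⁻ x, ENNReal.ofReal (|x| ^ (2 * N)) ∂(gaussianReal 0 1))
    (ENNReal.mul_ne_top ENNReal.ofReal_ne_top (lintegral_abs_pow_gaussianReal_ne_top N))
    fun m s t hst => by
      rw [((hV s).sub hW (hV t)).lintegral_abs_pow hW N, mul_right_comm]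
      gcongr
      refine le_trans (ENNReal.ofReal_le_ofReal ?_) (hrate m _ dist_nonneg hst)
      exact pow_le_pow_left₀ (integral_nonneg fun u => sq_nonneg _) (hinc s t) N
  exact ⟨X, fun t => (hV t).congr_ae (hX t)⟩

/-- Tightness of linear processes whose coefficients are Hölder continuous in `ℓ²`. -/
theorem isTightMeasureSet_of_linear {d : ℕ} {Ω ι : Type*} [MeasurableSpace Ω] {P : Measure Ω}
    [IsProbabilityMeasure P] {Z : ι → Ω → ℝ} (hmeas : ∀ k, Measurable (Z k))
    (hindep : iIndepFun Z P) (hident : ∀ j k, IdentDistrib (Z j) (Z k) P P)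
    (hmean : ∀ k, ∫ ω, Z k ω ∂P = 0)
    (hint : ∀ k (m : ℕ), Integrable (fun ω => |Z k ω| ^ m) P)
    {s : ℕ → Finset ι} {a : ℕ → Cube d → ι → ℝ} {Y : ℕ → Ω → C(Cube d, ℝ)}
    (hY : ∀ n ω t, Y n ω t = ∑ k ∈ s n, a n t k * Z k ω)
    (hY0 : ∀ n ω (z : Cube d), z.1 = 0 → Y n ω z = 0) {C η : ℝ} (hC : 0 ≤ C) (hη : 0 < η)
    (hinc : ∀ n x y, ∑ k ∈ s n, (a n x k - a n y k) ^ 2 ≤ C * dist x y ^ η) :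
    IsTightMeasureSet {P.map (Y n) | n} := by
  have hM : ∃ M : ℕ → ℝ, ∀ k m, ∫ ω, Z k ω ^ (2 * m) ∂P ≤ M m := by
    rcases isEmpty_or_nonempty ι with hι | ⟨⟨j⟩⟩
    · exact ⟨0, fun k => hι.elim k⟩
    · refine ⟨fun m => ∫ ω, Z j ω ^ (2 * m) ∂P, fun k m => le_of_eq ?_⟩
      exact ((hident k j).comp (u := fun x => x ^ (2 * m)) (by fun_prop)).integral_eq
  obtain ⟨M, hM⟩ := hM
  obtain ⟨N, hN, hrate⟩ := exists_pow_rate d hC hη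
  obtain ⟨A, hA, hmom⟩ := exists_moment_sum_le hmeas hindep hmean hint hM N
  refine isTightMeasureSet_of_moments (q := 2 * N) (by omega) (fun n t => ?_) hY0
    (M := ENNReal.ofReal A * ENNReal.ofReal (C ^ N))
    (ENNReal.mul_ne_top ENNReal.ofReal_ne_top ENNReal.ofReal_ne_top) fun n m x y hxy => ?_
  · simp only [hY]
    exact (Finset.measurable_fun_sum _ fun k _ => (hmeas k).const_mul _).aemeasurable
  · have e : ∀ ω, |Y n ω x - Y n ω y| ^ (2 * N) =
        (∑ k ∈ s n, (a n x k - a n y k) * Z k ω) ^ (2 * N) := fun ω => by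
      rw [(even_two_mul N).pow_abs, hY, hY, ← Finset.sum_sub_distrib]
      simp only [sub_mul]
    obtain ⟨h1, h2⟩ := hmom (s n) fun k => a n x k - a n y k
    simp only [e]
    rw [← ofReal_integral_eq_lintegral_ofReal h1
      (ae_of_all _ fun ω => (even_two_mul N).pow_nonneg _), mul_assoc]
    calc _ ≤ ENNReal.ofReal (A * (C * dist x y ^ η) ^ N) := by
          refine ENNReal.ofReal_le_ofReal (h2.trans ?_)
          gcongr
          exact hinc n x y
      _ = ENNReal.ofReal A * ENNReal.ofReal ((C * dist x y ^ η) ^ N) := ENNReal.ofReal_mul hA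
      _ ≤ _ := by
          gcongr
          exact hrate m _ dist_nonneg hxy

theorem mainTheorem1 {d : ℕ} (hd : 0 < d)
    {Ω : Type*} [MeasurableSpace Ω] (P : Measure Ω) [IsProbabilityMeasure P]
    {Ω' : Type*} [MeasurableSpace Ω'] (P' : Measure Ω') [IsProbabilityMeasure P']
    (Z : (Fin d → ℕ+) → Ω → ℝ)
    (hZ_meas : ∀ k, Measurable (Z k))
    (hZ_indep : iIndepFun Z P)
    (hZ_ident : ∀ j k, IdentDistrib (Z j) (Z k) P P)
    (hZ_mean : ∀ k, ∫ ω, Z k ω ∂P = 0)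
    (hZ_var : ∀ k, Var[Z k; P] = 1)
    (hZ_moments : ∀ k, ∀ m : ℕ, Integrable (fun ω => |Z k ω| ^ m) P)
    (W : Orthant d → Ω' → ℝ) (hW : IsWienerSheet W P')
    (H : (Fin d → ℝ) → Fin d → ℝ) (α β : Fin d → ℝ)
    (hα : ∀ i, 0 < α i) (hβ : ∀ i, β i < 1)
    (hH : ∀ t : Fin d → ℝ, 0 ≤ t → ∀ i, α i ≤ H t i ∧ H t i ≤ β i)
    (K γ : ℝ) (hK : 0 < K) (hγ : 0 < γ)
    (hH_holder : ∀ t s : Fin d → ℝ, 0 ≤ t → 0 ≤ s →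
      ‖WithLp.toLp 2 (H t - H s)‖ ≤ K * ‖WithLp.toLp 2 (t - s)‖ ^ γ) :
    (∀ n ω, ∀ t : Cube d, IntegrableOn
      (fun u => rlKernel H t u * theta (fun k => Z k ω) n u) (Set.Ici 0)) ∧
    (∃ X : Ω' → C(Cube d, ℝ), IsContinuousRLSheet H W P' X) ∧
    ∃ Y : ℕ → Ω → C(Cube d, ℝ),
      (∀ n ω, ∀ t : Cube d, Y n ω t = rlApprox H (fun k => Z k ω) n t) ∧
      ∀ X : Ω' → C(Cube d, ℝ), IsContinuousRLSheet H W P' X →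
        TendstoInDistribution Y atTop X (fun _ => P) P' := by
  have hmem : ∀ t : Cube d, MemLp (rlKernel H t) 2 (volume.restrict (Set.Ici 0)) :=
    memLp_rlKernel hd hα hβ hH
  have hbox : ∀ t : Cube d, MemLp (rlKernel H t) 2 (volume.restrict (unitBox d)) := fun t =>
    (hmem t).mono_measure (Measure.restrict_mono_set _ (unitBox_subset_Ici d))
  obtain ⟨C, η, hC, hη, hinc⟩ := exists_rlKernel_increment_le hd hα hβ hH hγ hH_holder
  let Y : ℕ → Ω → C(Cube d, ℝ) := fun n ω =>
    ⟨fun t => ∑ k ∈ cellIndices d n, cellCoeff n (rlKernel H t) k * Z k ω,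
      continuous_finsetSum _ fun k hk =>
        (continuous_cellCoeff_rlKernel hd hmem hη hinc hk).mul_const _⟩
  have hY : ∀ n ω t, Y n ω t = ∑ k ∈ cellIndices d n, cellCoeff n (rlKernel H t) k * Z k ω :=
    fun _ _ _ => rfl
  -- At the origin the kernel vanishes on the whole orthant, which supplies the anchoring used in
  -- the compactness argument.
  have hY0 : ∀ n ω (z : Cube d), z.1 = 0 → Y n ω z = 0 := by
    intro n ω z hz
    rw [hY]
    refine Finset.sum_eq_zero fun k hk => ?_
    rcases eq_or_ne n 0 with rfl | hn
    · rw [cellCoeff_zero hd, zero_mul]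
    · rw [cellCoeff, setIntegral_eq_zero_of_forall_eq_zero fun u hu =>
        rlKernel_eq_zero H ⟨0, hd⟩ ?_, mul_zero, zero_mul]
      rw [hz]
      exact unitBox_subset_Ici d (scaledCell_subset hn hk hu) _
  refine ⟨fun n ω t => (rlKernel_mul_theta_integrable hd t (hbox t) _ n).1,
    exists_isContinuousRLSheet hW hmem hC hη hinc, Y,
    fun n ω t => (rlKernel_mul_theta_integrable hd t (hbox t) _ n).2.symm, fun X hX => ?_⟩
  refine tendstoInDistribution_of_isTightMeasureSet
    (fun n t => (Finset.measurable_fun_sum _ fun k _ => (hZ_meas k).const_mul _).aemeasurable)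
    (fun t => (hX t).2.1.aestronglyMeasurable.aemeasurable)
    (isTightMeasureSet_of_linear hZ_meas hZ_indep hZ_ident hZ_mean hZ_moments hY hY0 hC hη
      fun n x y => (sum_cellCoeff_rlKernel_sub_sq_le hd hmem n x y).trans (hinc x y)) fun c => ?_
  -- Cramér–Wold: this one function carries both the linear combination of values of `X_n`, through
  -- its cell coefficients, and that of `X`, through its Wiener integral. The latter law depends
  -- only on `‖f‖²`, so the argument covers every continuous modification.
  set f : (Fin d → ℝ) → ℝ := fun u => ∑ t ∈ c.support, c t * rlKernel H t u with hf
  have hfbox : MemLp f 2 (volume.restrict (unitBox d)) :=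
    memLp_finsetSum _ fun t _ => (hbox t).const_mul _
  have hXf : IsWienerIntegral W P' f fun ω => ∑ t ∈ c.support, c t * X ω t :=
    IsWienerIntegral.sum hW _ fun t => (hX t).const_mul (c t)
  have hlim := tendsto_charFun_weighted_sum hZ_meas hZ_indep hZ_ident hZ_mean
    (fun k => by
      rw [← variance_of_integral_eq_zero (hZ_meas k).aemeasurable (hZ_mean k), hZ_var])
    (cellIndices d) (fun n => cellCoeff n f) _ (tendsto_sum_cellCoeff_sq hfbox)
    fun ε hε => eventually_abs_cellCoeff_lt hd hfbox hε
  rw [setIntegral_unitBox_eq_of_eq_zero fun u hu hb => by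
    rw [show f u = 0 from Finset.sum_eq_zero fun t _ => by
      rw [rlKernel_eq_zero_of_notMem_unitBox H t hu hb, mul_zero], zero_pow two_ne_zero]] at hlim
  have hgauss : charFun (P'.map fun ω => c.sum fun t a => a * X ω t) 1 =
      Complex.exp (-((∫ u in Set.Ici 0, f u ^ 2 : ℝ) : ℂ) / 2) := by
    simp only [Finsupp.sum]
    rw [hXf.map_eq hW, charFun_gaussianReal,
      Real.coe_toNNReal _ (integral_nonneg fun u => sq_nonneg _)]
    congr 1
    push_cast
    ring
  rw [hgauss]
  refine hlim.congr' ?_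
  filter_upwards [eventually_ne_atTop 0] with n hn
  congr 2
  ext ω
  simp only [Finsupp.sum, hY, Finset.mul_sum]
  rw [Finset.sum_comm]
  refine Finset.sum_congr rfl fun k hk => ?_
  rw [hf, cellCoeff_sum hn _ _ hbox hk, Finset.sum_mul]
  simp only [mul_assoc]
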